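/- Let $G$ be a finite group, $p$ a prime number, and $K$ a finite extension of $\mathbb{Q}_p$ such that the group algebra $KH$ is split for every subgroup $H$ of $G$. Let $\mathcal{O}$ be the integral closure of $\mathbb{Z}_p$ in $K$. A block idempotent of a ring is a primitive idempotent of its centre. For a finite group $H$, a $p$-block of $H$ is a set of irreducible characters of the form $\mathrm{Irr}(KHe)$, where $e$ is a block idempotent of $\mathcal{O}H$. Let $\mathcal{M}(G)$ be the set of $G$-conjugacy classes of pairs $(g,\gamma)$ with $g\in G$ and $\gamma\in\mathrm{Irr}(KC_G(g))$. Let $\mathbf{K}_G(G)$ be the Grothendieck ring of the category of $G$-equivariant finite-dimensional $K$-vector bundles on $G$ (for the conjugation action of $G$ on itself), with product induced by $(V\otimes W)_c=\bigoplus_{ab=c}V_a\otimes W_b$. For $(h,\eta)\in\mathcal{M}(G)$ let $V_{h,\eta}\in\mathbf{K}_G(G)$ be the class of the simple bundle supported on the conjugacy class of $h$ on whose fibre at $h$ the group $C_G(h)$ acts with character $\eta$. The $K$-algebra $K\mathbf{K}_G(G)=K\otimes_{\mathbb{Z}}\mathbf{K}_G(G)$ is split semisimple and commutative; its simple modules are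 one-dimensional and are given by the pairwise distinct characters $\Psi_{g,\gamma}$, $(g,\gamma)\in\mathcal{M}(G)$, where $$\Psi_{g,\gamma}(V_{h,\eta})=\frac{1}{\gamma(1)\,|C_G(h)|}\sum_{\substack{x\in G\\ xhx^{-1}\in C_G(g)}}\eta(x^{-1}gx)\,\gamma(xhx^{-1}).$$ A $p$-block of $\mathcal{M}(G)$ is a set of the form $\{(g,\gamma)\in\mathcal{M}(G) : \Psi_{g,\gamma}(e)=1\}$, where $e$ is a block idempotent of $\mathcal{O}\mathbf{K}_G(G)=\mathcal{O}\otimes_{\mathbb{Z}}\mathbf{K}_G(G)$. Proposition. Let $s\in G$ be a $p'$-element (an element of order prime to $p$) and let $\sigma,\sigma'\in\mathrm{Irr}(KC_G(s))$. Then $(s,\sigma)$ and $(s,\sigma')$ lie in the same $p$-block of $\mathcal{M}(G)$ if and only if $\sigma$ and $\sigma'$ lie in the same $p$-block of $C_G(s)$. -/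

import Mathlib

open scoped TensorProduct

noncomputable section

universe u v

namespace EquivBlocks

/-! ### Idempotents, irreducible characters, blocks of a finite group -/

/-- A block idempotent of a ring `R`: a primitive idempotent of the centre of `R`. -/
structure IsBlockIdempotent {R : Type*} [Ring R] (e : R) : Prop where
  mem_center : e ∈ Subring.center R
  idem : e * e = e
  ne_zero : e ≠ 0
  primitive : ∀ f f' : R, f ∈ Subring.center R → f' ∈ Subring.center R →
    f * f = f → f' * f' = f' → f * f' = 0 → e = f + f' → f = 0 ∨ f' = 0

/-- The group algebra `K H` is split: every endomorphism of a simple module is a scalar. -/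
def IsSplitGroupAlgebra (K : Type u) (H : Type v) [Field K] [Group H] : Prop :=
  ∀ (V : Type u) [AddCommGroup V] [Module K V] [FiniteDimensional K V]
    (ρ : Representation K H V), ρ.IsIrreducible →
    ∀ f : Representation.IntertwiningMap ρ ρ, ∃ c : K, f.toLinearMap = c • LinearMap.id

/-- `ρ` is an irreducible representation affording the character `χ`. -/
def Affords {K : Type u} {H : Type v} [Field K] [Group H] {V : Type u} [AddCommGroup V]
    [Module K V] (ρ : Representation K H V) (χ : H → K) : Prop :=
  ρ.IsIrreducible ∧ ρ.character = χ

/-- The set `Irr(K H)` of characters of irreducible finite-dimensional `K H`-modules. -/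
def Irr (K : Type u) (H : Type v) [Field K] [Group H] : Set (H → K) :=
  {χ | ∃ (V : Type u) (_ : AddCommGroup V) (_ : Module K V) (_ : FiniteDimensional K V)
    (ρ : Representation K H V), Affords ρ χ}

section Blocks

variable (p : ℕ) [Fact p.Prime] (K : Type u) [Field K] [Algebra ℤ_[p] K]

/-- The integral closure `𝒪` of `ℤ_p` in `K`. -/
abbrev IntegersOver : Subalgebra ℤ_[p] K := integralClosure ℤ_[p] K

/-- The set `Irr(K H e)` for an element `e` of `𝒪 H` (meant for central idempotents): the
characters of the irreducible representations of `H` over `K` on which `e` acts as the identity. -/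
def irrOfIdempotent {H : Type v} [Group H] (e : MonoidAlgebra (IntegersOver p K) H) :
    Set (H → K) :=
  {χ | ∃ (V : Type u) (_ : AddCommGroup V) (_ : Module K V) (_ : FiniteDimensional K V)
    (ρ : Representation K H V), Affords ρ χ ∧
      ρ.asAlgebraHom (MonoidAlgebra.mapRingHom H (algebraMap (IntegersOver p K) K) e) = 1}

/-- A `p`-block of `H`: a set of irreducible characters of the form `Irr(K H e)` with `e` a block
idempotent of `𝒪 H`. -/
def IsGroupBlock (H : Type v) [Group H] (B : Set (H → K)) : Prop :=
  ∃ e : MonoidAlgebra (IntegersOver p K) H, IsBlockIdempotent e ∧ B = irrOfIdempotent p K e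

end Blocks

/-! ### Equivariant vector bundles on `G` -/

/-- A `G`-equivariant finite-dimensional `K`-vector bundle on `G`, for the action by conjugation:
a finite-dimensional vector space `V = ⨁ a, V_a` (the total space of the bundle), with a
representation `ρ` of `G` such that `ρ x` maps the fibre `V_a` to `V_{x a x⁻¹}`. The decomposition
is given by the family of projections `proj a` of `V` onto the fibres `V_a`. -/
structure Bundle (K : Type u) (G : Type v) [Field K] [Group G] [Fintype G] where
  V : Type u
  [addCommGroup : AddCommGroup V]
  [module : Module K V]
  [finiteDimensional : FiniteDimensional K V]
  ρ : Representation K G V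
  proj : G → V →ₗ[K] V
  proj_self : ∀ a v, proj a (proj a v) = proj a v
  proj_ne : ∀ a b, a ≠ b → ∀ v, proj a (proj b v) = 0
  sum_proj : ∀ v, ∑ a, proj a v = v
  ρ_proj : ∀ x a v, ρ x (proj a v) = proj (x * a * x⁻¹) (ρ x v)

namespace Bundle

attribute [instance] addCommGroup module finiteDimensional

variable {K : Type u} {G : Type v} [Field K] [Group G] [Fintype G]

/-- The fibre `V_a`. -/
def fiber (E : Bundle K G) (a : G) : Submodule K E.V := LinearMap.range (E.proj a)

/-- For `x` in the centralizer of `a`, the trace of `x` on the fibre `V_a` (the operator `x ∘ proj a`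
vanishes on the other fibres). -/
def fiberTrace (E : Bundle K G) (a x : G) : K := LinearMap.trace K E.V (E.ρ x ∘ₗ E.proj a)

/-- Isomorphism of equivariant bundles. -/
def Iso (E F : Bundle K G) : Prop :=
  ∃ φ : E.V ≃ₗ[K] F.V, (∀ x v, φ (E.ρ x v) = F.ρ x (φ v)) ∧
    ∀ a v, φ (E.proj a v) = F.proj a (φ v)

theorem Iso.refl (E : Bundle K G) : Iso E E := ⟨LinearEquiv.refl K E.V, by simp, by simp⟩

theorem Iso.symm {E F : Bundle K G} : Iso E F → Iso F E := by
  rintro ⟨φ, h1, h2⟩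
  refine ⟨φ.symm, fun x v => ?_, fun a v => ?_⟩
  · rw [LinearEquiv.symm_apply_eq, h1, LinearEquiv.apply_symm_apply]
  · rw [LinearEquiv.symm_apply_eq, h2, LinearEquiv.apply_symm_apply]

theorem Iso.trans {E F H : Bundle K G} : Iso E F → Iso F H → Iso E H := by
  rintro ⟨φ, h1, h2⟩ ⟨ψ, h3, h4⟩
  exact ⟨φ.trans ψ, by simp [h1, h3], by simp [h2, h4]⟩

instance setoid : Setoid (Bundle K G) := ⟨Iso, Iso.refl, Iso.symm, Iso.trans⟩

/-- The direct sum of two bundles. -/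
def sum (E F : Bundle K G) : Bundle K G where
  V := E.V × F.V
  ρ := E.ρ.prod F.ρ
  proj a := (E.proj a).prodMap (F.proj a)
  proj_self := by rintro a ⟨v, w⟩; simp [proj_self]
  proj_ne := by rintro a b h ⟨v, w⟩; simp [proj_ne _ _ _ h]
  sum_proj := by rintro ⟨v, w⟩; ext <;> simp [sum_proj, Prod.fst_sum, Prod.snd_sum]
  ρ_proj := by rintro x a ⟨v, w⟩; simp [ρ_proj]

theorem proj_proj [DecidableEq G] (E : Bundle K G) (a b : G) (v : E.V) :
    E.proj a (E.proj b v) = if a = b then E.proj b v else 0 := by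
  split_ifs with h
  · rw [h, E.proj_self]
  · exact E.proj_ne a b h v

/-- The projection of `E ⊗ F` on the fibre of the convolution product at `c`. -/
def tensorProj (E F : Bundle K G) (c : G) : E.V ⊗[K] F.V →ₗ[K] E.V ⊗[K] F.V :=
  ∑ a, TensorProduct.map (E.proj a) (F.proj (a⁻¹ * c))

theorem tensorProj_tmul (E F : Bundle K G) (c : G) (v : E.V) (w : F.V) :
    tensorProj E F c (v ⊗ₜ w) = ∑ a, E.proj a v ⊗ₜ F.proj (a⁻¹ * c) w := by
  simp [tensorProj]

theorem tensorProj_proj (E F : Bundle K G) [DecidableEq G] (a b c : G) (v : E.V) (w : F.V) :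
    tensorProj E F c (E.proj a v ⊗ₜ F.proj b w) =
      if c = a * b then E.proj a v ⊗ₜ F.proj b w else 0 := by
  rw [tensorProj_tmul, Finset.sum_eq_single a]
  · rw [proj_self, proj_proj]
    simp only [inv_mul_eq_iff_eq_mul]
    split_ifs <;> simp
  · intro x _ hx
    rw [proj_ne _ _ _ hx, TensorProduct.zero_tmul]
  · simp

/-- Every vector of a tensor product of bundles is a sum of homogeneous tensors. -/
theorem tmul_eq_sum (E F : Bundle K G) (v : E.V) (w : F.V) :
    v ⊗ₜ[K] w = ∑ a, ∑ b, E.proj a v ⊗ₜ[K] F.proj b w := by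
  conv_lhs => rw [← E.sum_proj v, ← F.sum_proj w]
  simp only [TensorProduct.sum_tmul, TensorProduct.tmul_sum]
  exact Finset.sum_comm

/-- Two linear maps on a tensor product agree if they agree on homogeneous tensors. -/
theorem ext_hom (E F : Bundle K G) {W : Type*} [AddCommGroup W] [Module K W]
    {f g : E.V ⊗[K] F.V →ₗ[K] W}
    (h : ∀ a b v w, f (E.proj a v ⊗ₜ F.proj b w) = g (E.proj a v ⊗ₜ F.proj b w)) : f = g := by
  refine TensorProduct.ext' fun v w => ?_
  rw [tmul_eq_sum]
  simp only [map_sum, h]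

open Classical in
/-- The product of two bundles: `(E ⊗ F)_c = ⨁_{a b = c} E_a ⊗ F_b`, with `G` acting
diagonally. -/
def tensor (E F : Bundle K G) : Bundle K G where
  V := E.V ⊗[K] F.V
  ρ := E.ρ.tprod F.ρ
  proj := tensorProj E F
  proj_self c := by
    refine LinearMap.congr_fun (f := tensorProj E F c ∘ₗ tensorProj E F c) (ext_hom E F ?_)
    intro a b v w
    simp only [LinearMap.comp_apply, tensorProj_proj]
    split_ifs with h
    · rw [tensorProj_proj, if_pos h]
    · simp
  proj_ne c d hcd := by
    refine LinearMap.congr_fun (f := tensorProj E F c ∘ₗ tensorProj E F d) (g := 0)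
      (ext_hom E F ?_)
    intro a b v w
    simp only [LinearMap.comp_apply, tensorProj_proj]
    split_ifs with h
    · rw [tensorProj_proj, if_neg (fun h' => hcd (h'.trans h.symm))]; rfl
    · simp
  sum_proj v := by
    have : ∑ c, tensorProj E F c = LinearMap.id := by
      refine ext_hom E F ?_
      intro a b v w
      simp [LinearMap.sum_apply, tensorProj_proj]
    simpa [LinearMap.sum_apply] using LinearMap.congr_fun this v
  ρ_proj x c := by
    refine LinearMap.congr_fun (f := (E.ρ.tprod F.ρ) x ∘ₗ tensorProj E F c)
      (g := tensorProj E F (x * c * x⁻¹) ∘ₗ (E.ρ.tprod F.ρ) x) (ext_hom E F ?_)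
    intro a b v w
    simp only [LinearMap.comp_apply, tensorProj_proj, Representation.tprod_apply,
      TensorProduct.map_tmul, ρ_proj]
    have : x * c * x⁻¹ = x * a * x⁻¹ * (x * b * x⁻¹) ↔ c = a * b := by
      rw [show x * a * x⁻¹ * (x * b * x⁻¹) = x * (a * b) * x⁻¹ by group]
      simp
    simp only [this]
    split_ifs <;> simp [ρ_proj]

open Classical in
/-- The unit bundle: the trivial representation, concentrated at the neutral element. -/
def one : Bundle K G where
  V := K
  ρ := Representation.trivial K G K
  proj a := if a = 1 then LinearMap.id else 0
  proj_self a v := by split_ifs <;> simp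
  proj_ne a b h v := by
    by_cases ha : a = 1
    · have hb : b ≠ 1 := fun hb => h (ha.trans hb.symm)
      simp [hb]
    · simp [ha]
  sum_proj v := by
    rw [Finset.sum_eq_single 1] <;> simp +contextual
  ρ_proj x a v := by
    have : x * a * x⁻¹ = 1 ↔ a = 1 := conj_eq_one_iff
    simp only [this]
    split_ifs <;> simp

theorem sum_congr {E E' F F' : Bundle K G} (h : Iso E E') (h' : Iso F F') :
    Iso (sum E F) (sum E' F') := by
  obtain ⟨φ, h1, h2⟩ := h
  obtain ⟨ψ, h3, h4⟩ := h'
  refine ⟨φ.prodCongr ψ, ?_, ?_⟩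
  · rintro x ⟨v, w⟩
    exact Prod.ext (h1 x v) (h3 x w)
  · rintro x ⟨v, w⟩
    exact Prod.ext (h2 x v) (h4 x w)

/-- A criterion for a linear isomorphism to be an isomorphism of bundles `E ⊗ F → H`. -/
theorem iso_of_tensor [DecidableEq G] {E F H : Bundle K G} (φ : E.V ⊗[K] F.V ≃ₗ[K] H.V)
    (h1 : ∀ x v w, φ (E.ρ x v ⊗ₜ F.ρ x w) = H.ρ x (φ (v ⊗ₜ w)))
    (h2 : ∀ c a b v w, H.proj c (φ (E.proj a v ⊗ₜ F.proj b w)) =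
      if c = a * b then φ (E.proj a v ⊗ₜ F.proj b w) else 0) : Iso (tensor E F) H := by
  refine ⟨φ, fun x => ?_, fun c => ?_⟩
  · refine LinearMap.congr_fun (f := φ.toLinearMap ∘ₗ (E.ρ.tprod F.ρ) x)
      (g := H.ρ x ∘ₗ φ.toLinearMap) (TensorProduct.ext' fun v w => ?_)
    simpa using h1 x v w
  · refine LinearMap.congr_fun (f := φ.toLinearMap ∘ₗ tensorProj E F c)
      (g := H.proj c ∘ₗ φ.toLinearMap) (ext_hom E F fun a b v w => ?_)
    simp only [LinearMap.comp_apply, tensorProj_proj, LinearEquiv.coe_coe, h2]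
    split_ifs <;> simp

theorem tensor_congr {E E' F F' : Bundle K G} (h : Iso E E') (h' : Iso F F') :
    Iso (tensor E F) (tensor E' F') := by
  classical
  obtain ⟨φ, h1, h2⟩ := h
  obtain ⟨ψ, h3, h4⟩ := h'
  refine iso_of_tensor (H := tensor E' F') (TensorProduct.congr φ ψ) ?_ ?_
  · intro x v w
    change φ (E.ρ x v) ⊗ₜ[K] ψ (F.ρ x w) = E'.ρ x (φ v) ⊗ₜ[K] F'.ρ x (ψ w)
    rw [h1, h3]
  · intro c a b v w
    change tensorProj E' F' c (φ (E.proj a v) ⊗ₜ[K] ψ (F.proj b w)) =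
      if c = a * b then φ (E.proj a v) ⊗ₜ[K] ψ (F.proj b w) else 0
    rw [h2, h4, tensorProj_proj]

theorem tensor_assoc (E F H : Bundle K G) :
    Iso (tensor (tensor E F) H) (tensor E (tensor F H)) := by
  refine ⟨TensorProduct.assoc K E.V F.V H.V, fun x => ?_, fun c => ?_⟩
  · refine LinearMap.congr_fun
      (f := (TensorProduct.assoc K E.V F.V H.V).toLinearMap ∘ₗ ((E.ρ.tprod F.ρ).tprod H.ρ) x)
      (g := (E.ρ.tprod (F.ρ.tprod H.ρ)) x ∘ₗ (TensorProduct.assoc K E.V F.V H.V).toLinearMap)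
      (TensorProduct.ext_threefold fun u v w => ?_)
    simp
  · refine LinearMap.congr_fun
      (f := (TensorProduct.assoc K E.V F.V H.V).toLinearMap ∘ₗ tensorProj (tensor E F) H c)
      (g := tensorProj E (tensor F H) c ∘ₗ (TensorProduct.assoc K E.V F.V H.V).toLinearMap)
      (TensorProduct.ext_threefold fun u v w => ?_)
    have e1 : tensorProj (tensor E F) H c ((u ⊗ₜ[K] v) ⊗ₜ[K] w) =
        ∑ a, ∑ b, (E.proj b u ⊗ₜ[K] F.proj (b⁻¹ * a) v) ⊗ₜ[K] H.proj (a⁻¹ * c) w := by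
      have h := tensorProj_tmul (tensor E F) H c (u ⊗ₜ[K] v) w
      refine h.trans (Finset.sum_congr rfl fun a _ => ?_)
      rw [← TensorProduct.sum_tmul]
      congr 1
      exact tensorProj_tmul E F a u v
    have e2 : tensorProj E (tensor F H) c (u ⊗ₜ[K] (v ⊗ₜ[K] w)) =
        ∑ b, ∑ a, E.proj b u ⊗ₜ[K] (F.proj a v ⊗ₜ[K] H.proj (a⁻¹ * (b⁻¹ * c)) w) := by
      have h := tensorProj_tmul E (tensor F H) c u (v ⊗ₜ[K] w)
      refine h.trans (Finset.sum_congr rfl fun a _ => ?_)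
      rw [← TensorProduct.tmul_sum]
      congr 1
      exact tensorProj_tmul F H (a⁻¹ * c) v w
    have e3 : (TensorProduct.assoc K E.V F.V H.V)
        (tensorProj (tensor E F) H c ((u ⊗ₜ[K] v) ⊗ₜ[K] w)) =
        tensorProj E (tensor F H) c (u ⊗ₜ[K] (v ⊗ₜ[K] w)) := by
      rw [e1, e2]
      simp only [map_sum, TensorProduct.assoc_tmul]
      rw [Finset.sum_comm]
      refine Finset.sum_congr rfl fun b _ => ?_
      refine Fintype.sum_equiv (Equiv.mulLeft b⁻¹) _ _ fun a => ?_
      simp [mul_assoc]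
    exact e3

/-- The braiding `v ⊗ w ↦ a w ⊗ v` for `v` in the fibre at `a`. -/
def braid (E F : Bundle K G) : E.V ⊗[K] F.V →ₗ[K] F.V ⊗[K] E.V :=
  ∑ a, TensorProduct.map (F.ρ a) (E.proj a) ∘ₗ (TensorProduct.comm K E.V F.V).toLinearMap

/-- The inverse of the braiding. -/
def braidInv (E F : Bundle K G) : F.V ⊗[K] E.V →ₗ[K] E.V ⊗[K] F.V :=
  ∑ a, TensorProduct.map (E.proj a) (F.ρ a⁻¹) ∘ₗ (TensorProduct.comm K F.V E.V).toLinearMap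

theorem braid_proj (E F : Bundle K G) (a : G) (v : E.V) (w : F.V) :
    braid E F (E.proj a v ⊗ₜ w) = F.ρ a w ⊗ₜ E.proj a v := by
  simp only [braid, LinearMap.sum_apply, LinearMap.comp_apply, LinearEquiv.coe_coe,
    TensorProduct.comm_tmul, TensorProduct.map_tmul]
  rw [Finset.sum_eq_single a]
  · rw [proj_self]
  · intro b _ hb
    rw [proj_ne _ _ _ hb, TensorProduct.tmul_zero]
  · simp

theorem braidInv_proj (E F : Bundle K G) (a : G) (v : E.V) (w : F.V) :
    braidInv E F (w ⊗ₜ E.proj a v) = E.proj a v ⊗ₜ F.ρ a⁻¹ w := by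
  simp only [braidInv, LinearMap.sum_apply, LinearMap.comp_apply, LinearEquiv.coe_coe,
    TensorProduct.comm_tmul, TensorProduct.map_tmul]
  rw [Finset.sum_eq_single a]
  · rw [proj_self]
  · intro b _ hb
    rw [proj_ne _ _ _ hb, TensorProduct.zero_tmul]
  · simp

theorem tensor_comm (E F : Bundle K G) : Iso (tensor E F) (tensor F E) := by
  classical
  have h12 : braid E F ∘ₗ braidInv E F = LinearMap.id := by
    refine ext_hom F E fun a b w v => ?_
    rw [LinearMap.comp_apply, braidInv_proj, braid_proj]
    simp
  have h21 : braidInv E F ∘ₗ braid E F = LinearMap.id := by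
    refine ext_hom E F fun a b v w => ?_
    rw [LinearMap.comp_apply, braid_proj, braidInv_proj]
    simp
  refine iso_of_tensor (H := tensor F E) (LinearEquiv.ofLinearMap (braid E F) (braidInv E F) h12 h21)
    ?_ ?_
  · intro x v w
    change braid E F _ = (F.ρ.tprod E.ρ) x (braid E F _)
    have hv := E.sum_proj v
    rw [← hv]
    simp only [map_sum, TensorProduct.sum_tmul]
    refine Finset.sum_congr rfl fun a _ => ?_
    rw [braid_proj, ρ_proj, braid_proj]
    simp only [Representation.tprod_apply, TensorProduct.map_tmul, ρ_proj]
    congr 1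
    simp [← Module.End.mul_apply, ← map_mul]
  · intro c a b v w
    change tensorProj F E c (braid E F _) = if c = a * b then braid E F _ else 0
    rw [braid_proj, ρ_proj, tensorProj_proj]
    simp

theorem one_tensor (E : Bundle K G) : Iso (tensor one E) E := by
  classical
  refine iso_of_tensor (E := one) (F := E) (TensorProduct.lid K E.V) ?_ ?_
  · intro x (v : K) w
    change v • E.ρ x w = E.ρ x (v • w)
    rw [map_smul]
  · intro c a b (v : K) w
    change E.proj c ((TensorProduct.lid K E.V)
      ((if a = 1 then LinearMap.id else (0 : K →ₗ[K] K)) v ⊗ₜ E.proj b w)) =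
      if c = a * b then (TensorProduct.lid K E.V)
      ((if a = 1 then LinearMap.id else (0 : K →ₗ[K] K)) v ⊗ₜ E.proj b w) else 0
    by_cases h : a = 1
    · simp only [h, if_true, one_mul, LinearMap.id_apply, TensorProduct.lid_tmul, map_smul,
        proj_proj]
      split_ifs <;> simp
    · simp [h]

theorem tensor_sum (E F H : Bundle K G) :
    Iso (tensor E (sum F H)) (sum (tensor E F) (tensor E H)) := by
  classical
  refine iso_of_tensor (H := sum (tensor E F) (tensor E H))
    (TensorProduct.prodRight K K E.V F.V H.V) ?_ ?_
  · rintro x u ⟨v, w⟩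
    rfl
  · rintro c a b u ⟨v, w⟩
    change (tensorProj E F c (E.proj a u ⊗ₜ F.proj b v), tensorProj E H c (E.proj a u ⊗ₜ H.proj b w))
      = if c = a * b then (E.proj a u ⊗ₜ[K] F.proj b v, E.proj a u ⊗ₜ[K] H.proj b w) else 0
    rw [tensorProj_proj, tensorProj_proj]
    split_ifs <;> rfl

theorem fiberTrace_congr {E F : Bundle K G} (h : Iso E F) (a x : G) :
    E.fiberTrace a x = F.fiberTrace a x := by
  obtain ⟨φ, h1, h2⟩ := h
  have : F.ρ x ∘ₗ F.proj a = φ.conj (E.ρ x ∘ₗ E.proj a) := by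
    ext v
    simp [LinearEquiv.conj_apply, h1, h2]
  rw [fiberTrace, fiberTrace, this, LinearMap.trace_conj']

theorem fiberTrace_sum (E F : Bundle K G) (a x : G) :
    (sum E F).fiberTrace a x = E.fiberTrace a x + F.fiberTrace a x :=
  LinearMap.trace_prodMap' (E.ρ x ∘ₗ E.proj a) (F.ρ x ∘ₗ F.proj a)

theorem fiberTrace_conj (E : Bundle K G) (a x y : G) :
    E.fiberTrace (y * a * y⁻¹) (y * x * y⁻¹) = E.fiberTrace a x := by
  have h : E.ρ (y * x * y⁻¹) ∘ₗ E.proj (y * a * y⁻¹) =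
      (E.ρ y ∘ₗ (E.ρ x ∘ₗ E.proj a)) ∘ₗ E.ρ y⁻¹ := by
    ext v
    have h := E.ρ_proj y a (E.ρ y⁻¹ v)
    rw [← Module.End.mul_apply (E.ρ y) (E.ρ y⁻¹), ← map_mul] at h
    simp only [mul_inv_cancel, map_one, Module.End.one_apply] at h
    simp [← h, map_mul, Module.End.mul_apply]
  rw [fiberTrace, h, LinearMap.trace_comp_comm', ← LinearMap.comp_assoc, ← Module.End.mul_eq_comp,
    ← Module.End.mul_eq_comp, ← map_mul, inv_mul_cancel, map_one, one_mul]
  rfl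

end Bundle

/-! ### The Grothendieck ring -/

section GrothendieckRing

variable (K : Type u) (G : Type v) [Field K] [Group G] [Fintype G]

/-- Isomorphism classes of equivariant bundles. -/
def BundleClass : Type _ := Quotient (Bundle.setoid (K := K) (G := G))

variable {K G}

/-- The isomorphism class of a bundle. -/
def BundleClass.mk (E : Bundle K G) : BundleClass K G := Quotient.mk _ E

theorem BundleClass.ind {P : BundleClass K G → Prop} (h : ∀ E, P (BundleClass.mk E)) (c) : P c :=
  Quotient.inductionOn c h

/-- Isomorphism classes of bundles form a commutative monoid under the tensor product. -/
instance : CommMonoid (BundleClass K G) where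
  mul := Quotient.map₂ Bundle.tensor fun _ _ h _ _ h' => Bundle.tensor_congr h h'
  one := BundleClass.mk Bundle.one
  mul_assoc := by
    rintro ⟨E⟩ ⟨F⟩ ⟨H⟩
    exact Quotient.sound (Bundle.tensor_assoc E F H)
  mul_comm := by
    rintro ⟨E⟩ ⟨F⟩
    exact Quotient.sound (Bundle.tensor_comm E F)
  one_mul := by
    rintro ⟨E⟩
    exact Quotient.sound (Bundle.one_tensor E)
  mul_one := by
    rintro ⟨E⟩
    exact Quotient.sound ((Bundle.tensor_comm E _).trans (Bundle.one_tensor E))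

theorem BundleClass.mk_mul (E F : Bundle K G) :
    BundleClass.mk E * BundleClass.mk F = BundleClass.mk (E.tensor F) := rfl

variable (K G) in
/-- The relations `[E ⊕ F] - [E] - [F]`. -/
def sumRelations : Set (FreeAbelianGroup (BundleClass K G)) :=
  {r | ∃ E F : Bundle K G, r = FreeAbelianGroup.of (BundleClass.mk (E.sum F)) -
    FreeAbelianGroup.of (BundleClass.mk E) - FreeAbelianGroup.of (BundleClass.mk F)}

variable (K G) in
/-- The Grothendieck ring `K_G(G)` of `G`-equivariant bundles on `G`: the free abelian group on
isomorphism classes, with the product induced by the tensor product, modulo the relations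
`[E ⊕ F] = [E] + [F]`. -/
abbrev GrothendieckRing : Type _ :=
  FreeAbelianGroup (BundleClass K G) ⧸ Ideal.span (sumRelations K G)

/-- The class of a bundle in `K_G(G)`. -/
def bundleClass (E : Bundle K G) : GrothendieckRing K G :=
  Ideal.Quotient.mk _ (FreeAbelianGroup.of (BundleClass.mk E))

/-- As the tensor product distributes over the direct sum, the ideal generated by the relations is
the additive subgroup that they generate. -/
theorem mem_closure_of_mem_span {r : FreeAbelianGroup (BundleClass K G)}
    (hr : r ∈ Ideal.span (sumRelations K G)) : r ∈ AddSubgroup.closure (sumRelations K G) := by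
  have key : ∀ (a x : FreeAbelianGroup (BundleClass K G)),
      x ∈ AddSubgroup.closure (sumRelations K G) →
      a * x ∈ AddSubgroup.closure (sumRelations K G) := by
    intro a x hx
    induction a using FreeAbelianGroup.induction_on with
    | zero => simp
    | of c =>
      induction hx using AddSubgroup.closure_induction with
      | mem y hy =>
        obtain ⟨E, F, rfl⟩ := hy
        induction c using BundleClass.ind with
        | h D =>
          refine AddSubgroup.subset_closure ⟨D.tensor E, D.tensor F, ?_⟩
          rw [mul_sub, mul_sub, FreeAbelianGroup.of_mul_of, FreeAbelianGroup.of_mul_of,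
            FreeAbelianGroup.of_mul_of, BundleClass.mk_mul, BundleClass.mk_mul,
            BundleClass.mk_mul]
          congr 3
          exact Quotient.sound (Bundle.tensor_sum D E F)
      | zero => simp
      | add y z _ _ hy hz => rw [mul_add]; exact add_mem hy hz
      | neg y _ hy => rw [mul_neg]; exact neg_mem hy
    | neg c hc => rw [neg_mul]; exact neg_mem hc
    | add c d hc hd => rw [add_mul]; exact add_mem hc hd
  refine Submodule.span_induction (fun x hx => AddSubgroup.subset_closure hx) (zero_mem _)
    (fun x y _ _ hx hy => add_mem hx hy) (fun a x _ hx => ?_) hr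
  exact key a x hx

/-- The function on isomorphism classes given by the trace of `x` on the fibre at `a`. -/
def BundleClass.fiberTrace (a x : G) (c : BundleClass K G) : K :=
  Quotient.lift (fun E : Bundle K G => E.fiberTrace a x)
    (fun _ _ h => Bundle.fiberTrace_congr h a x) c

theorem BundleClass.fiberTrace_mk (a x : G) (E : Bundle K G) :
    BundleClass.fiberTrace a x (BundleClass.mk E) = E.fiberTrace a x := rfl

/-- The additive map on `K_G(G)` given by the trace of `x` on the fibre at `a`. -/
def fiberTraceHom (a x : G) : GrothendieckRing K G →+ K :=
  QuotientAddGroup.lift (Submodule.toAddSubgroup (Ideal.span (sumRelations K G)))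
    (FreeAbelianGroup.lift (BundleClass.fiberTrace a x))
    (by
      intro r hr
      refine (AddSubgroup.closure_le _).2 ?_ (mem_closure_of_mem_span hr)
      rintro _ ⟨E, F, rfl⟩
      rw [SetLike.mem_coe, AddMonoidHom.mem_ker, map_sub, map_sub, FreeAbelianGroup.lift_apply_of,
        FreeAbelianGroup.lift_apply_of, FreeAbelianGroup.lift_apply_of, sub_sub, sub_eq_zero]
      exact Bundle.fiberTrace_sum E F a x)

theorem fiberTraceHom_bundleClass (a x : G) (E : Bundle K G) :
    fiberTraceHom a x (bundleClass E) = E.fiberTrace a x :=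
  FreeAbelianGroup.lift_apply_of (BundleClass.fiberTrace a x) (BundleClass.mk E)

end GrothendieckRing

/-! ### The set `ℳ(G)`, Fourier coefficients, and the characters of the Grothendieck ring -/

section Pairs

variable {K : Type u} {G : Type v} [Field K] [Group G]

open Classical in
/-- Extension by zero to `G` of a function on the centralizer of `g`. -/
def extendZero {g : G} (γ : Subgroup.centralizer {g} → K) (x : G) : K :=
  if h : x ∈ Subgroup.centralizer {g} then γ ⟨x, h⟩ else 0

variable (K G) in
/-- Pairs `(g, γ)` with `g ∈ G` and `γ` an irreducible character of the centralizer of `g`. -/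
abbrev IrrPairs : Type _ := Σ g : G, Irr K (Subgroup.centralizer {g})

/-- The pairs `P = (g, γ)` and `Q = (g', γ')` are conjugate under `G`. -/
def IrrPairs.Conj (P Q : IrrPairs K G) : Prop :=
  ∃ x : G, Q.1 = x * P.1 * x⁻¹ ∧
    ∀ (z : Subgroup.centralizer {P.1}) (z' : Subgroup.centralizer {Q.1}),
      (z' : G) = x * z * x⁻¹ → Q.2.1 z' = P.2.1 z

theorem mem_centralizer_iff' {g x : G} : x ∈ Subgroup.centralizer {g} ↔ g * x = x * g :=
  Subgroup.mem_centralizer_singleton_iff.trans eq_comm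

theorem mem_conj_centralizer {g h x : G} :
    x⁻¹ * h * x ∈ Subgroup.centralizer {g} ↔ x * g * x⁻¹ ∈ Subgroup.centralizer {h} := by
  rw [mem_centralizer_iff', mem_centralizer_iff']
  constructor
  · intro e
    calc h * (x * g * x⁻¹) = x * (x⁻¹ * h * x * g) * x⁻¹ := by group
      _ = x * (g * (x⁻¹ * h * x)) * x⁻¹ := by rw [e]
      _ = _ := by group
  · intro e
    calc g * (x⁻¹ * h * x) = x⁻¹ * (x * g * x⁻¹ * h) * x := by group
      _ = x⁻¹ * (h * (x * g * x⁻¹)) * x := by rw [e]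
      _ = _ := by group

theorem conj_mem_centralizer {g z : G} (x : G) (hz : z ∈ Subgroup.centralizer {g}) :
    x * z * x⁻¹ ∈ Subgroup.centralizer {x * g * x⁻¹} := by
  rw [mem_centralizer_iff'] at *
  rw [show x * g * x⁻¹ * (x * z * x⁻¹) = x * (g * z) * x⁻¹ by group, hz]
  group

variable (K G) in
/-- Conjugacy of pairs under `G`. -/
instance pairSetoid : Setoid (IrrPairs K G) where
  r := IrrPairs.Conj
  iseqv := by
    refine ⟨fun P => ⟨1, by simp, fun z z' h => ?_⟩, ?_, ?_⟩
    · have h' : z' = z := Subtype.ext (by simpa using h)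
      rw [h']
    · rintro P Q ⟨x, hx, h⟩
      refine ⟨x⁻¹, by rw [hx]; group, fun z z' hz => (h z' z ?_).symm⟩
      rw [hz]; group
    · rintro P Q R ⟨x, hx, h⟩ ⟨y, hy, h'⟩
      refine ⟨y * x, by rw [hy, hx]; group, fun z z' hz => ?_⟩
      have hm := conj_mem_centralizer x z.2
      rw [← hx] at hm
      rw [← h z ⟨_, hm⟩ rfl]
      refine h' _ _ ?_
      rw [hz]; group

variable (K G) in
/-- The set `ℳ(G)` of `G`-orbits of pairs. -/
def MPairs : Type _ := Quotient (pairSetoid K G)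

/-- The element of `ℳ(G)` given by a pair. -/
def MPairs.mk (P : IrrPairs K G) : MPairs K G := Quotient.mk _ P

variable [Fintype G]

open Classical in
/-- The Fourier coefficient
`{(g, γ), (h, η)} = (|C_G(g)| |C_G(h)|)⁻¹ ∑ γ(x h x⁻¹) η(x⁻¹ g⁻¹ x)`, the sum over the `x ∈ G` with
`x h x⁻¹ ∈ C_G(g)`. Here `γ` and `η` are functions on `G` that stand for functions on `C_G(g)` and
`C_G(h)`, only their values there matter. -/
def fourier (g : G) (γ : G → K) (h : G) (η : G → K) : K :=
  ((Nat.card (Subgroup.centralizer {g}) : K) * (Nat.card (Subgroup.centralizer {h}) : K))⁻¹ *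
    ∑ x : G with x * h * x⁻¹ ∈ Subgroup.centralizer {g}, γ (x * h * x⁻¹) * η (x⁻¹ * g⁻¹ * x)

/-- `E` is the simple bundle `V_{h, η}`: it is supported by the conjugacy class of `h`, and the
centralizer of `h` acts on the fibre at `h` with the irreducible character `η`. -/
def Bundle.IsSimpleFor (E : Bundle K G) (h : G) (η : Irr K (Subgroup.centralizer {h})) : Prop :=
  (∀ a, ¬ IsConj h a → E.fiber a = ⊥) ∧
    ∀ z : Subgroup.centralizer {h}, E.fiberTrace h z = η.1 z

open Classical in
/-- The homomorphism `Ψ_{g, γ} : K_G(G) → K`, as an additive map. On the class of a bundle `E` it is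
`γ(1)⁻¹ ∑_{a ∈ C_G(g)} γ(a) tr(g | E_a)`. -/
def psiHom (P : IrrPairs K G) : GrothendieckRing K G →+ K :=
  ∑ a : Subgroup.centralizer {P.1},
    (AddMonoidHom.mulLeft ((P.2.1 1)⁻¹ * P.2.1 a)).comp (fiberTraceHom (a : G) P.1)

open Classical in
theorem psiHom_bundleClass (P : IrrPairs K G) (E : Bundle K G) :
    psiHom P (bundleClass E) =
      (P.2.1 1)⁻¹ * ∑ a : Subgroup.centralizer {P.1}, P.2.1 a * E.fiberTrace a P.1 := by
  simp [psiHom, fiberTraceHom_bundleClass, Finset.mul_sum, mul_assoc]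

theorem card_conj_eq {h a : G} (ha : IsConj h a) [DecidableEq G] :
    ({x | x⁻¹ * h * x = a} : Finset G).card = Nat.card (Subgroup.centralizer {h}) := by
  obtain ⟨c, rfl⟩ := isConj_iff.1 ha
  rw [← SetLike.coe_sort_coe, Nat.card_coe_set_eq, ← Set.ncard_coe_finset]
  refine Set.ncard_congr (fun x _ => x * c) ?_ (fun x y _ _ hxy => mul_right_cancel hxy) ?_
  · intro x hx
    have hx' : x⁻¹ * h * x = c * h * c⁻¹ := by simpa using hx
    rw [SetLike.mem_coe, mem_centralizer_iff']
    have : h * x = x * (c * h * c⁻¹) := by rw [← hx']; group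
    rw [← mul_assoc, this]
    group
  · intro y hy
    rw [SetLike.mem_coe, mem_centralizer_iff'] at hy
    refine ⟨y * c⁻¹, ?_, by group⟩
    simp only [Finset.coe_filter, Finset.mem_univ, true_and, Set.mem_ofPred_eq]
    rw [show (y * c⁻¹)⁻¹ * h * (y * c⁻¹) = c * y⁻¹ * (h * y) * c⁻¹ by group, hy]
    group

/-- On the class of the simple bundle `V_{h, η}`, the map `Ψ_{g, γ}` takes the value
`|C_G(g)| γ(1)⁻¹ {(h⁻¹, η), (g, γ)}`. -/
theorem psiHom_simple [CharZero K] (P : IrrPairs K G) (h : G)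
    (η : Irr K (Subgroup.centralizer {h})) (E : Bundle K G) (hE : E.IsSimpleFor h η) :
    psiHom P (bundleClass E) = (Nat.card (Subgroup.centralizer {P.1}) : K) / P.2.1 1 *
      fourier h⁻¹ (extendZero η.1) P.1 (extendZero P.2.1) := by
  classical
  have hc : Subgroup.centralizer {h⁻¹} = Subgroup.centralizer {h} := by
    ext x
    rw [mem_centralizer_iff', mem_centralizer_iff', inv_mul_eq_iff_eq_mul, ← mul_assoc,
      eq_mul_inv_iff_mul_eq, eq_comm]
  set g := P.1
  set F : G → K := fun a => extendZero P.2.1 a * E.fiberTrace a g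
  have hzero : ∀ a, ¬ IsConj h a → F a = 0 := by
    intro a ha
    have : E.proj a = 0 := LinearMap.range_eq_bot.1 (hE.1 a ha)
    simp [F, Bundle.fiberTrace, this]
  have h1 : ∑ x : G with x * g * x⁻¹ ∈ Subgroup.centralizer {h⁻¹},
      extendZero η.1 (x * g * x⁻¹) * extendZero P.2.1 (x⁻¹ * h⁻¹⁻¹ * x) =
      ∑ x : G, F (x⁻¹ * h * x) := by
    rw [Finset.sum_filter]
    refine Finset.sum_congr rfl fun x _ => ?_
    rw [hc, inv_inv]
    split_ifs with hx
    · have e := E.fiberTrace_conj (x⁻¹ * h * x) g x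
      rw [show x * (x⁻¹ * h * x) * x⁻¹ = h by group] at e
      have e' := hE.2 ⟨_, hx⟩
      simp only [F]
      rw [← e, e', extendZero, dif_pos hx, mul_comm]
    · have : x⁻¹ * h * x ∉ Subgroup.centralizer {g} := fun h' => hx (mem_conj_centralizer.1 h')
      simp only [F]
      rw [extendZero, dif_neg this, zero_mul]
  have h2 : ∑ x : G, F (x⁻¹ * h * x) =
      (Nat.card (Subgroup.centralizer {h}) : K) * ∑ a, F a := by
    rw [← Finset.sum_fiberwise Finset.univ (fun x : G => x⁻¹ * h * x), Finset.mul_sum]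
    refine Finset.sum_congr rfl fun a _ => ?_
    rw [Finset.sum_congr rfl (g := fun _ => F a)
      (fun x hx => by rw [(Finset.mem_filter.1 hx).2]), Finset.sum_const, nsmul_eq_mul]
    by_cases ha : IsConj h a
    · rw [card_conj_eq ha]
    · rw [hzero a ha, mul_zero, mul_zero]
  have h3 : ∑ a, F a = ∑ a : Subgroup.centralizer {g}, P.2.1 a * E.fiberTrace a g := by
    have e : ∀ a : Subgroup.centralizer {g}, P.2.1 a * E.fiberTrace a g = F a := by
      intro a
      simp only [F]
      rw [extendZero, dif_pos a.2]
    rw [Finset.sum_congr rfl fun a _ => e a,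
      ← Finset.sum_subtype ({a | a ∈ Subgroup.centralizer {g}} : Finset G) (by simp) F]
    refine (Finset.sum_filter_of_ne fun a _ ha => ?_).symm
    by_contra hn
    exact ha (by simp only [F]; rw [extendZero, dif_neg hn, zero_mul])
  have c1 : (Nat.card (Subgroup.centralizer {g}) : K) ≠ 0 := Nat.cast_ne_zero.2 Nat.card_pos.ne'
  have c2 : (Nat.card (Subgroup.centralizer {h}) : K) ≠ 0 := Nat.cast_ne_zero.2 Nat.card_pos.ne'
  rw [psiHom_bundleClass, fourier, h1, h2, h3, hc]
  field_simp
  rfl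

/-- The `K`-linear map `Ψ_{g, γ} : K ⊗ K_G(G) → K`. -/
def psi (P : IrrPairs K G) : K ⊗[ℤ] GrothendieckRing K G →ₗ[K] K :=
  LinearMap.liftBaseChange K (psiHom P).toIntLinearMap

end Pairs

section MBlocks

variable (p : ℕ) [Fact p.Prime] (K : Type u) (G : Type v) [Field K] [Algebra ℤ_[p] K]
  [Group G] [Fintype G]

/-- The ring `𝒪 K_G(G) = 𝒪 ⊗ K_G(G)`. -/
abbrev IntegralGrothendieckRing : Type _ := IntegersOver p K ⊗[ℤ] GrothendieckRing K G

/-- The canonical ring homomorphism `𝒪 K_G(G) → K K_G(G)`. -/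
def toFieldCoeff : IntegralGrothendieckRing p K G →ₐ[ℤ] K ⊗[ℤ] GrothendieckRing K G :=
  Algebra.TensorProduct.map (algebraMap (IntegersOver p K) K).toIntAlgHom
    (AlgHom.id ℤ (GrothendieckRing K G))

variable {K G} in
/-- The set of the elements of `ℳ(G)` whose simple module, the one-dimensional module with
character `Ψ_{g, γ}`, is a module for the block of `K K_G(G)` defined by `e`. -/
def pairsOfIdempotent (e : IntegralGrothendieckRing p K G) : Set (MPairs K G) :=
  {m | ∃ P : IrrPairs K G, MPairs.mk P = m ∧ psi P (toFieldCoeff p K G e) = 1}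

/-- A `p`-block of `ℳ(G)`: the set of elements of `ℳ(G)` that belong to a block idempotent of
`𝒪 K_G(G)`. -/
def IsMBlock (B : Set (MPairs K G)) : Prop :=
  ∃ e : IntegralGrothendieckRing p K G, IsBlockIdempotent e ∧ B = pairsOfIdempotent p e

end MBlocks

end EquivBlocks

end

noncomputable section

universe u v

namespace EquivBlocks

/-! ### Block idempotents of commutative algebras that are finite over `ℤ_p` -/

/-! Both kinds of blocks are read off from characters of commutative `𝒪`-algebras that are finite
over `ℤ_p`. For such an algebra `R`, two characters `R → 𝒪` take the value 1 on a common block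
idempotent exactly when they are congruent modulo a prime ideal `m` of `𝒪` that contains `p`
(`exists_block_iff_congr`). If they are not congruent, idempotent lifting produces an idempotent
that separates them.

On the group side the algebra is the centre `Z` of `𝒪 C_G(s)`, and `σ` gives its central character
`ω_σ : Z → 𝒪` (`exists_centralCharacter`). On the bundle side it is `𝒪 K_G(G)`, which is finite
because every simple bundle is a quotient of one of finitely many regular bundles
(`finite_grothendieckRing`). The two are linked by the homomorphism `Φ` sending `[E]` to `∑ a, tr(s
| E_a) a`, the sum over `a ∈ C_G(s)` (`toCenterAlgHom`). It satisfies `Ψ_{s,σ} = ω_σ ∘ Φ`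
(`psi_eq_centralCharacter`). Therefore, once `Φ` is surjective, congruence of `Ψ_{s,σ}` and
`Ψ_{s,σ'}` is the same as congruence of `ω_σ` and `ω_σ'`.

Surjectivity is where `s` has to be a `p'`-element. For `h ∈ C_G(s)`, right translations by `C_G(h)`
are endomorphisms of the regular bundle at `h`. Let `P` be a Sylow `p`-subgroup of `N = C_G(s) ∩
C_G(h)`, and let `T` be right translation by `s` times the averaging idempotent of `P`. The operator
`T` is diagonalizable with eigenvalues 0 or powers of a root of unity `ζ`, and its eigenspaces are
sub-bundles `E_j`. The image of `∑ ζ^j [E_j]` under `Φ` has coefficient `tr(ρ(s) proj_a T)` at `a`.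
This trace counts, with weight `1/|P|`, the pairs `(x, y)` in `G × P` with `x h x⁻¹ = a` and `s y =
x⁻¹ s x`. As `s` is a `p'`-element and `y` is a `p`-element commuting with it, `y = 1` and `x ∈
C_G(s)`. The result is `[N : P]` times the class sum of `h` (`exists_coeff_eq_classSum`), and `[N :
P]` is a unit of `𝒪`. -/

theorem isPrecomplete_of_finite {R : Type*} [CommRing R] (I : Ideal R) [IsPrecomplete I R]
    (M : Type*) [AddCommGroup M] [Module R M] [Module.Finite R M] : IsPrecomplete I M := by
  -- The completion of a finite module is a quotient of `R^ ⊗ M`, and precompleteness of `R` lets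
  -- each coefficient in `R^` be replaced by an element of `R`.
  have hs : Function.Surjective (AdicCompletion.of I M) := by
    intro y
    obtain ⟨t, rfl⟩ := AdicCompletion.ofTensorProduct_surjective_of_finite I M y
    induction t using TensorProduct.induction_on with
    | zero => exact ⟨0, by simp⟩
    | tmul r x =>
      obtain ⟨r, rfl⟩ := AdicCompletion.of_surjective I R r
      refine ⟨r • x, ?_⟩
      rw [AdicCompletion.ofTensorProduct_tmul, map_smul]
      ext n
      rfl
    | add a b ha hb =>
      obtain ⟨x, hx⟩ := ha
      obtain ⟨y, hy⟩ := hb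
      exact ⟨x + y, by simp [hx, hy]⟩
  refine ⟨fun f hf => ?_⟩
  obtain ⟨L, hL⟩ := hs ⟨fun n => Submodule.Quotient.mk (f n), fun {m n} h => by
    have := hf h
    rw [SModEq.def] at this
    simpa using this.symm⟩
  refine ⟨L, fun n => ?_⟩
  have := congrArg (fun z => z.1 n) hL
  rw [SModEq.def]
  exact this.symm

theorem exists_pow_mul_self {M : Type*} [Monoid M] [Finite M] (x : M) :
    ∃ n, n ≠ 0 ∧ x ^ n * x ^ n = x ^ n := by
  obtain ⟨i, j, hij, h⟩ := Finite.exists_ne_map_eq_of_infinite (fun n : ℕ => x ^ n)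
  wlog hlt : i < j generalizing i j
  · exact this j i hij.symm h.symm (lt_of_le_of_ne (not_lt.1 hlt) hij.symm)
  -- From the exponent `i` on, powers of `x` have period `d`. A multiple of `d` that is at least `i`
  -- therefore gives an idempotent power; the factor `i + 1` keeps it nonzero when `i = 0`.
  obtain ⟨d, hd, rfl⟩ : ∃ d, d ≠ 0 ∧ j = i + d := ⟨j - i, by omega, by omega⟩
  have step : ∀ k m, i ≤ m → x ^ (m + k * d) = x ^ m := by
    intro k
    induction k with
    | zero => simp
    | succ k ih =>
      intro m hm
      obtain ⟨r, rfl⟩ := Nat.exists_eq_add_of_le hm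
      rw [show i + r + (k + 1) * d = (i + d) + (r + k * d) by ring, pow_add, ← h, ← pow_add,
        ← add_assoc, ih _ hm]
  refine ⟨(i + 1) * d, by positivity, ?_⟩
  rw [← pow_add, step]
  nlinarith [Nat.pos_of_ne_zero hd]

/-- In a finite commutative `ℤ_p`-algebra every element has a power that is congruent modulo `p` to
an idempotent. -/
theorem exists_idempotent_congr_pow (p : ℕ) [Fact p.Prime] {R : Type*} [CommRing R]
    [Algebra ℤ_[p] R] [Module.Finite ℤ_[p] R] (x : R) :
    ∃ n, n ≠ 0 ∧ ∃ e : R, e * e = e ∧ ∃ y, e = x ^ n + p * y := by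
  set I : Ideal R := (IsLocalRing.maximalIdeal ℤ_[p]).map (algebraMap ℤ_[p] R) with hI
  -- With `I = (p)`, the ring `R` is `I`-adically complete and `R ⧸ I` is finite. Some power of `x`
  -- is thus idempotent modulo `I`, and Hensel's lemma for `X ^ 2 - X` lifts it.
  have hspan : I = Ideal.span {(p : R)} := by
    rw [hI, PadicInt.maximalIdeal_eq_span_p, Ideal.map_span]
    simp
  have : IsHausdorff I R := by
    have : IsHausdorff (IsLocalRing.maximalIdeal ℤ_[p]) R := inferInstance
    exact (IsHausdorff.map_algebraMap_iff).2 this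
  have : IsPrecomplete I R :=
    IsPrecomplete.map_algebraMap_iff.2 (isPrecomplete_of_finite _ R)
  have : IsAdicComplete I R := ⟨⟩
  have hf : Finite (R ⧸ I) := by
    have : Finite (ℤ_[p] ⧸ IsLocalRing.maximalIdeal ℤ_[p]) :=
      Finite.of_equiv _ (PadicInt.residueField (p := p)).toEquiv.symm
    have : Module.Finite (ℤ_[p] ⧸ IsLocalRing.maximalIdeal ℤ_[p]) (R ⧸ I) :=
      Module.Finite.of_restrictScalars_finite ℤ_[p] _ _
    exact Module.finite_of_finite (ℤ_[p] ⧸ IsLocalRing.maximalIdeal ℤ_[p])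
  obtain ⟨n, hn, hx⟩ := exists_pow_mul_self (Ideal.Quotient.mk I x)
  have hx' : Ideal.Quotient.mk I (x ^ n) * Ideal.Quotient.mk I (x ^ n) =
      Ideal.Quotient.mk I (x ^ n) := by simpa using hx
  obtain ⟨e, he, hex⟩ := HenselianRing.is_henselian (I := I) (Polynomial.X ^ 2 - Polynomial.X)
    (by monicity!) (x ^ n)
    (by
      rw [← Ideal.Quotient.eq_zero_iff_mem]
      simp only [Polynomial.eval_sub, Polynomial.eval_pow, Polynomial.eval_X, map_sub]
      rw [sq, map_mul, hx', sub_self])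
    (by
      -- The derivative at an idempotent `u` is its own inverse: `(2u - 1)² = 1 + 4(u² - u) = 1`.
      have : (Ideal.Quotient.mk I (x ^ n) * 2 - 1) * (Ideal.Quotient.mk I (x ^ n) * 2 - 1) = 1 := by
        linear_combination 4 * hx'
      have hd : Polynomial.eval (x ^ n) (Polynomial.derivative (Polynomial.X ^ 2 - Polynomial.X)) =
          x ^ n * 2 - 1 := by
        simp only [Polynomial.derivative_sub, Polynomial.derivative_X_sq, Polynomial.derivative_X,
          Polynomial.eval_sub, Polynomial.eval_mul, Polynomial.eval_C, Polynomial.eval_X,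
          Polynomial.eval_one]
        ring
      rw [hd, map_sub, map_mul, map_one, map_ofNat]
      exact IsUnit.of_mul_eq_one _ this)
  rw [hspan, Ideal.mem_span_singleton] at hex
  obtain ⟨y, hy⟩ := hex
  refine ⟨n, hn, e, ?_, y, by linear_combination hy⟩
  have := he
  simp only [Polynomial.IsRoot, Polynomial.eval_sub, Polynomial.eval_pow, Polynomial.eval_X] at this
  linear_combination this

/-- Among the idempotents `e` with `f e = 1`, choose one whose ideal `(1 - e)` is maximal. If `e`
splits as `g + g'`, then `f` is 1 on one summand because `D` is a domain. Passing to that summand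
enlarges the ideal unless the other summand is zero. -/
theorem exists_isBlockIdempotent {R D : Type*} [CommRing R] [IsNoetherianRing R] [CommRing D]
    [IsDomain D] (f : R →+* D) : ∃ e : R, IsBlockIdempotent e ∧ f e = 1 := by
  let S : Set (Ideal R) := {J | ∃ e : R, e * e = e ∧ f e = 1 ∧ J = Ideal.span {1 - e}}
  obtain ⟨J, ⟨e, he, hfe, rfl⟩, hmax⟩ := set_has_maximal_iff_noetherian.2
    (inferInstance : IsNoetherian R R) S ⟨_, 1, by simp, by simp, rfl⟩
  have key : ∀ g g' : R, g * g = g → g' * g' = g' → g * g' = 0 → e = g + g' → f g = 1 → g' = 0 := by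
    intro g g' hg hg' h0 hs hfg
    have hle : Ideal.span {1 - e} ≤ Ideal.span {1 - g} := by
      rw [Ideal.span_singleton_le_span_singleton]
      exact ⟨1 - e, by rw [hs]; linear_combination -hg - h0⟩
    have := eq_of_le_of_not_lt hle (hmax _ ⟨g, hg, hfg, rfl⟩)
    have h1 : 1 - g ∈ Ideal.span {1 - e} := this ▸ Ideal.mem_span_singleton_self _
    obtain ⟨c, hc⟩ := Ideal.mem_span_singleton.1 h1
    have : e * (1 - g) = 0 := by rw [hc]; linear_combination -c * he
    rw [hs] at this
    linear_combination this + hg + h0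
  refine ⟨e, ⟨by simp, he, ?_, ?_⟩, hfe⟩
  · rintro rfl
    simp at hfe
  · intro g g' _ _ hg hg' h0 hs
    have h1 : f g = 0 ∨ f g = 1 := by
      have : f g * (f g - 1) = 0 := by rw [mul_sub, ← map_mul, hg, mul_one, sub_self]
      rcases mul_eq_zero.1 this with h | h
      · exact .inl h
      · exact .inr (sub_eq_zero.1 h)
    rcases h1 with h1 | h1
    · refine .inl (key g' g hg' hg (by rw [mul_comm, h0]) (by rw [hs, add_comm]) ?_)
      rw [← hfe, hs, map_add, h1, zero_add]
    · exact .inr (key g g' hg hg' h0 hs h1)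

theorem eq_zero_or_one_of_idem {D : Type*} [Ring D] [IsDomain D] {d : D} (h : d * d = d) :
    d = 0 ∨ d = 1 := by
  have : d * (d - 1) = 0 := by rw [mul_sub, h, mul_one, sub_self]
  exact (mul_eq_zero.1 this).imp id sub_eq_zero.1

/-- Two characters `f, f' : R → D` of a commutative algebra that is finite over `ℤ_p` belong to the
same block idempotent if and only if they are congruent modulo a prime ideal over `p`. -/
theorem exists_block_iff_congr (p : ℕ) [Fact p.Prime] {R D : Type*} [CommRing R]
    [Algebra ℤ_[p] R] [Module.Finite ℤ_[p] R] [CommRing D] [IsDomain D] [Algebra D R]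
    (m : Ideal D) [hm : m.IsPrime] (hp : (p : D) ∈ m) (f f' : R →ₐ[D] D) :
    (∃ e : R, IsBlockIdempotent e ∧ f e = 1 ∧ f' e = 1) ↔ ∀ x, f x - f' x ∈ m := by
  have one_notMem : (1 : D) ∉ m := fun h => hm.ne_top (m.eq_top_iff_one.2 h)
  constructor
  · rintro ⟨e, he, hfe, hfe'⟩ x
    by_contra hx
    set y := x - algebraMap D R (f x) with hy
    have hfy : f y = 0 := by simp [hy]
    have hfy' : f' y ∉ m := by
      intro h
      refine hx ?_
      have : f' y = f' x - f x := by simp [hy]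
      rw [this] at h
      simpa using m.neg_mem h
    obtain ⟨n, hn, e0, h0, z, hz⟩ := exists_idempotent_congr_pow p y
    have i0 : f e0 = 0 := by
      refine (eq_zero_or_one_of_idem (by rw [← map_mul, h0])).resolve_right fun h1 => ?_
      refine one_notMem ?_
      rw [← h1, hz, map_add, map_pow, hfy, zero_pow hn, zero_add, map_mul, map_natCast]
      exact m.mul_mem_right _ hp
    have i1 : f' e0 = 1 := by
      refine (eq_zero_or_one_of_idem (by rw [← map_mul, h0])).resolve_left fun h1 => ?_
      refine hfy' (hm.mem_of_pow_mem n ?_)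
      have : f' y ^ n = - (p * f' z) := by
        rw [hz, map_add, map_mul, map_natCast, map_pow] at h1
        linear_combination h1
      rw [this]
      exact m.neg_mem (m.mul_mem_right _ hp)
    have hee := he.idem
    rcases he.primitive (e * e0) (e * (1 - e0)) (by simp) (by simp)
      (by linear_combination e0 * e0 * hee + e * h0)
      (by linear_combination (1 - e0) * (1 - e0) * hee + e * h0)
      (by linear_combination -e * e * h0) (by ring) with h | h
    · have := congrArg f' h
      simp [hfe', i1] at this
    · have := congrArg f h
      simp [hfe, i0] at this
  · intro h
    have : IsNoetherianRing R := IsNoetherianRing.of_finite ℤ_[p] R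
    obtain ⟨e, he, hfe⟩ := exists_isBlockIdempotent (f : R →+* D)
    have hfe : f e = 1 := hfe
    refine ⟨e, he, hfe, ?_⟩
    refine (eq_zero_or_one_of_idem (by rw [← map_mul, he.idem])).resolve_left fun h1 => ?_
    have := h e
    rw [hfe, h1, sub_zero] at this
    exact one_notMem this

/-! ### Central characters -/

theorem mem_center_of_comm {R : Type*} [CommRing R] (x : R) : x ∈ Subring.center R :=
  Subring.mem_center_iff.2 fun y => mul_comm y x

/-- Primitivity only tests decompositions into central idempotents, so it can be checked inside the
centre. This allows the commutative criterion to be applied to blocks of group algebras. -/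
theorem isBlockIdempotent_center_iff {D R : Type*} [CommRing D] [Ring R] [Algebra D R]
    (e : Subalgebra.center D R) : IsBlockIdempotent e ↔ IsBlockIdempotent (e : R) := by
  constructor
  · rintro ⟨-, h2, h3, h4⟩
    refine ⟨e.2, congrArg Subtype.val h2, fun h => h3 (Subtype.ext h), ?_⟩
    intro f f' hf hf' i i' h0 hs
    have := h4 ⟨f, hf⟩ ⟨f', hf'⟩ (mem_center_of_comm _) (mem_center_of_comm _)
      (Subtype.ext i) (Subtype.ext i') (Subtype.ext h0) (Subtype.ext hs)
    exact this.imp (congrArg Subtype.val) (congrArg Subtype.val)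
  · rintro ⟨-, h2, h3, h4⟩
    refine ⟨mem_center_of_comm _, Subtype.ext h2, fun h => h3 (congrArg Subtype.val h), ?_⟩
    intro f f' _ _ i i' h0 hs
    have := h4 f f' f.2 f'.2 (congrArg Subtype.val i) (congrArg Subtype.val i')
      (congrArg Subtype.val h0) (congrArg Subtype.val hs)
    exact this.imp Subtype.ext Subtype.ext

theorem charZero_of_algebra_padic (p : ℕ) [Fact p.Prime] (K : Type*) [Field K] [Algebra ℚ_[p] K] :
    CharZero K :=
  charZero_of_injective_algebraMap (algebraMap ℚ_[p] K).injective

theorem isUnit_natCast_integersOver {p : ℕ} [Fact p.Prime] {K : Type u} [Field K]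
    [Algebra ℤ_[p] K] {n : ℕ} (h : n.Coprime p) : IsUnit (n : IntegersOver p K) := by
  have : IsUnit (n : ℤ_[p]) := by
    rw [PadicInt.isUnit_iff, PadicInt.norm_natCast_eq_one_iff]
    exact h.symm
  simpa using this.map (algebraMap ℤ_[p] (IntegersOver p K))

section

variable (p : ℕ) [Fact p.Prime] (K : Type u) [Field K] [Algebra ℚ_[p] K]
    [FiniteDimensional ℚ_[p] K] [Algebra ℤ_[p] K] [IsScalarTower ℤ_[p] ℚ_[p] K]

instance finite_integersOver : Module.Finite ℤ_[p] (IntegersOver p K) :=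
  IsIntegralClosure.finite ℤ_[p] ℚ_[p] K (IntegersOver p K)

/-- Lying over for the integral extension `ℤ_p ⊆ 𝒪`. -/
theorem exists_isPrime_natCast_mem :
    ∃ m : Ideal (IntegersOver p K), m.IsPrime ∧ (p : IntegersOver p K) ∈ m := by
  have hinj : Function.Injective (algebraMap ℤ_[p] (IntegersOver p K)) := by
    have : Function.Injective (algebraMap ℤ_[p] K) := by
      rw [IsScalarTower.algebraMap_eq ℤ_[p] ℚ_[p] K]
      exact (algebraMap ℚ_[p] K).injective.comp (IsFractionRing.injective ℤ_[p] ℚ_[p])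
    exact Function.Injective.of_comp (f := algebraMap (IntegersOver p K) K) this
  have : Algebra.IsIntegral ℤ_[p] (IntegersOver p K) := Algebra.IsIntegral.of_finite _ _
  obtain ⟨m, hm, h⟩ := Ideal.exists_ideal_over_maximal_of_isIntegral (S := IntegersOver p K)
    (IsLocalRing.maximalIdeal ℤ_[p])
    (by rw [(RingHom.injective_iff_ker_eq_bot _).1 hinj]; exact bot_le)
  refine ⟨m, hm.isPrime, ?_⟩
  have : (p : ℤ_[p]) ∈ m.comap (algebraMap ℤ_[p] (IntegersOver p K)) := by
    rw [h, PadicInt.maximalIdeal_eq_span_p]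
    exact Ideal.mem_span_singleton_self _
  simpa using this

variable {p K} in
/-- The central character of the irreducible character `χ`. -/
theorem exists_centralCharacter {H : Type v} [Group H] [Finite H] (hsplit : IsSplitGroupAlgebra K H)
    {χ : H → K} (hχ : χ ∈ Irr K H) :
    χ 1 ≠ 0 ∧
    ∃ ω : Subalgebra.center (IntegersOver p K) (MonoidAlgebra (IntegersOver p K) H)
      →ₐ[IntegersOver p K] IntegersOver p K,
      (∀ z, (ω z : K) * χ 1 = z.1.coeff.sum fun a c => (c : K) * χ a) ∧
      ∀ z, χ ∈ irrOfIdempotent p K z.1 ↔ ω z = 1 := by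
  have := charZero_of_algebra_padic p K
  let O := IntegersOver p K
  let Z := Subalgebra.center O (MonoidAlgebra O H)
  -- This is proved for every representation affording `χ`, since membership in `irrOfIdempotent`
  -- supplies its own. The trace formula shows that the Schur scalar depends on `χ` alone.
  have main : ∀ (V : Type u) (_ : AddCommGroup V) (_ : Module K V) (_ : FiniteDimensional K V)
      (ρ : Representation K H V), Affords ρ χ → χ 1 ≠ 0 ∧ ∀ z : Z, ∃ c : K,
        ρ.asAlgebraHom (MonoidAlgebra.mapRingHom H (algebraMap O K) z.1) = c • LinearMap.id ∧
        c * χ 1 = z.1.coeff.sum fun a c => (c : K) * χ a := by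
    rintro V _ _ _ ρ ⟨hirr, rfl⟩
    have hV : Nontrivial V := by
      by_contra hn
      rw [not_nontrivial_iff_subsingleton] at hn
      have := hirr.toNontrivial
      exact bot_ne_top (α := Subrepresentation ρ)
        (Subrepresentation.toSubmodule_injective (Subsingleton.elim _ _))
    refine ⟨?_, fun z => ?_⟩
    · rw [Representation.char_one]
      exact Nat.cast_ne_zero.2 Module.finrank_pos.ne'
    · let T := ρ.asAlgebraHom (MonoidAlgebra.mapRingHom H (algebraMap O K) z.1)
      have hT : ∀ h, T ∘ₗ ρ h = ρ h ∘ₗ T := by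
        intro h
        have hz := Subalgebra.mem_center_iff.1 z.2 (MonoidAlgebra.single h 1)
        have := congrArg (fun y => ρ.asAlgebraHom (MonoidAlgebra.mapRingHom H (algebraMap O K) y)) hz
        simp only [map_mul] at this
        have h1 : ρ.asAlgebraHom (MonoidAlgebra.mapRingHom H (algebraMap O K)
            (MonoidAlgebra.single h 1)) = ρ h := by simp
        rw [h1] at this
        exact this.symm
      obtain ⟨c, hc⟩ := hsplit V ρ hirr ⟨T, hT⟩
      refine ⟨c, hc, ?_⟩
      have htr := congrArg (LinearMap.trace K V) hc
      rw [map_smul, LinearMap.trace_id, smul_eq_mul] at htr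
      rw [Representation.char_one, ← htr]
      change LinearMap.trace K V T = _
      have : ∀ x : MonoidAlgebra O H, LinearMap.trace K V
          (ρ.asAlgebraHom (MonoidAlgebra.mapRingHom H (algebraMap O K) x)) =
          x.coeff.sum fun a c => (c : K) * ρ.character a := by
        intro x
        induction x using MonoidAlgebra.induction_linear with
        | zero => simp
        | add x y hx hy =>
          rw [map_add, map_add, map_add, hx, hy, MonoidAlgebra.coeff_add, Finsupp.sum_add_index']
          · simp
          · simp [add_mul]
        | single a c =>
          simp only [MonoidAlgebra.coe_mapRingHom, MonoidAlgebra.map_single, map_smul,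
            Representation.asAlgebraHom_single, MonoidAlgebra.coeff_single, smul_eq_mul]
          rw [Finsupp.sum_single_index (by simp)]
          rfl
      exact this z
  obtain ⟨V, i1, i2, i3, ρ, hρ⟩ := hχ
  obtain ⟨h1, hz⟩ := main V i1 i2 i3 ρ hρ
  refine ⟨h1, ?_⟩
  choose φ hφ hφ' using hz
  have hV : Nontrivial V := by
    by_contra hn
    rw [not_nontrivial_iff_subsingleton] at hn
    refine h1 ?_
    rw [← hρ.2, Representation.char_one, Module.finrank_zero_of_subsingleton, Nat.cast_zero]
  have inj : ∀ {a b : K}, a • (LinearMap.id : V →ₗ[K] V) = b • LinearMap.id → a = b := by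
    intro a b h
    obtain ⟨v, hv⟩ := exists_ne (0 : V)
    exact smul_left_injective K hv (LinearMap.congr_fun h v)
  have hone : (1 : Module.End K V) = LinearMap.id := rfl
  let φ' : Z →ₐ[O] K :=
    { toFun := φ
      map_one' := inj (by rw [← hφ]; simp [hone])
      map_mul' := fun x y => inj (by
        rw [← hφ, MulMemClass.coe_mul, map_mul, map_mul, hφ, hφ, ← hone, smul_mul_smul_comm, one_mul])
      map_zero' := inj (by rw [← hφ]; simp)
      map_add' := fun x y => inj (by
        rw [← hφ, AddMemClass.coe_add, map_add, map_add, hφ, hφ, add_smul])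
      commutes' := fun r => inj (by
        rw [← hφ, Subalgebra.coe_algebraMap, MonoidAlgebra.coe_algebraMap]
        simp only [MonoidAlgebra.coe_mapRingHom, Function.comp_apply, MonoidAlgebra.map_single,
          Representation.asAlgebraHom_single, map_one]
        rfl) }
  have : IsNoetherianRing O := IsNoetherianRing.of_finite ℤ_[p] O
  have : Module.Finite O (MonoidAlgebra O H) :=
    Module.Finite.equiv (MonoidAlgebra.coeffLinearEquiv O).symm
  have : Module.Finite O Z :=
    Module.Finite.of_injective Z.val.toLinearMap Subtype.val_injective
  -- The centre is finite, hence integral, over `𝒪`. The values of `φ'` are therefore integral over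
  -- `ℤ_p`.
  have hint : ∀ z : Z, φ' z ∈ integralClosure ℤ_[p] K := by
    intro z
    have h1 : IsIntegral O z := IsIntegral.of_finite O z
    have h2 : IsIntegral O (φ' z) := h1.map φ'
    have : Algebra.IsIntegral ℤ_[p] O := Algebra.IsIntegral.of_finite _ _
    exact isIntegral_trans _ h2
  let ω : Z →ₐ[O] O :=
    { (φ' : Z →+* K).codRestrict O hint with
      commutes' := fun r => Subtype.ext (φ'.commutes r) }
  refine ⟨ω, hφ', fun z => ⟨?_, fun h => ⟨V, i1, i2, i3, ρ, hρ, ?_⟩⟩⟩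
  · rintro ⟨W, j1, j2, j3, τ, hτ, h⟩
    obtain ⟨-, hz⟩ := main W j1 j2 j3 τ hτ
    obtain ⟨c, hc, hc'⟩ := hz z
    have hW : Nontrivial W := by
      by_contra hn
      rw [not_nontrivial_iff_subsingleton] at hn
      refine h1 ?_
      rw [← hτ.2, Representation.char_one, Module.finrank_zero_of_subsingleton, Nat.cast_zero]
    have c1 : c = 1 := by
      obtain ⟨v, hv⟩ := exists_ne (0 : W)
      refine smul_left_injective K hv ?_
      have := LinearMap.congr_fun (hc.symm.trans h) v
      simpa using this
    refine Subtype.ext (mul_right_cancel₀ h1 ?_)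
    have : φ z * χ 1 = _ := hφ' z
    rw [← hc', c1] at this
    exact this
  · rw [hφ, show φ z = 1 from congrArg Subtype.val h, one_smul]
    rfl

end

/-! ### Roots of unity -/

/-- An operator `T` with `T ^ (n + 1) = T` is diagonalizable over a field that contains the `n`-th
roots of unity. -/
theorem exists_idempotents_of_pow_succ_eq {K A : Type*} [Field K] [CharZero K] [Ring A] [Algebra K A]
    {n : ℕ} (hn : n ≠ 0) {ζ : K} (hζ : IsPrimitiveRoot ζ n) (T : A) (hT : T ^ (n + 1) = T) :
    ∃ π : ℕ → A, (∀ j, π j * π j = π j) ∧ T = ∑ j ∈ Finset.range n, ζ ^ j • π j ∧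
      ∀ j S, Commute S T → Commute S (π j) := by
  have hn' : (n : K) ≠ 0 := Nat.cast_ne_zero.2 hn
  have hζ0 : ζ ≠ 0 := hζ.ne_zero hn
  set z : ℕ → K := fun j => (ζ ^ j)⁻¹ with hz
  have hz0 : ∀ j, z j ≠ 0 := fun j => inv_ne_zero (pow_ne_zero _ hζ0)
  have hzn : ∀ j, z j ^ n = 1 := fun j => by
    rw [hz, inv_pow, ← pow_mul, mul_comm, pow_mul, hζ.pow_eq_one, one_pow, inv_one]
  -- The polynomial `n⁻¹ ∑ (X / ζ^j)^i`, for `1 ≤ i ≤ n`, is 1 at `ζ^j` and 0 at the other roots of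
  -- `X^(n+1) - X`. Starting at exponent 1 makes it vanish at the root 0. Being polynomials in `T`,
  -- the projectors commute with whatever commutes with `T`.
  let π : ℕ → A := fun j => (n : K)⁻¹ • ∑ i ∈ Finset.range n, z j ^ (i + 1) • T ^ (i + 1)
  have h1 : ∀ j, T * π j = ζ ^ j • π j := by
    intro j
    -- Shifting the exponent only replaces the first term by the term of exponent `n + 1`, and these
    -- agree because `z j ^ n = 1` and `T ^ (n + 1) = T`.
    have hs : ∑ i ∈ Finset.range n, z j ^ (i + 1 + 1) • T ^ (i + 1 + 1) =
        ∑ i ∈ Finset.range n, z j ^ (i + 1) • T ^ (i + 1) := by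
      have e1 := Finset.sum_range_succ (fun i => z j ^ (i + 1) • T ^ (i + 1)) n
      have e2 := Finset.sum_range_succ' (fun i => z j ^ (i + 1) • T ^ (i + 1)) n
      rw [e1, hT, pow_succ (z j) n, hzn] at e2
      simpa using e2.symm
    have : ζ ^ j = (z j)⁻¹ := by rw [hz, inv_inv]
    simp only [π]
    rw [mul_smul_comm, smul_comm]
    congr 1
    rw [this]
    conv_rhs => rw [← hs]
    rw [Finset.mul_sum, Finset.smul_sum]
    refine Finset.sum_congr rfl fun i _ => ?_
    rw [mul_smul_comm, ← pow_succ', smul_smul, pow_succ' (z j) (i + 1), inv_mul_cancel_left₀ (hz0 j)]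
  have h2 : ∀ j i, T ^ i * π j = (ζ ^ j) ^ i • π j := by
    intro j i
    induction i with
    | zero => simp
    | succ i ih =>
      rw [pow_succ, mul_assoc, h1, mul_smul_comm, ih, smul_smul, ← pow_succ']
  refine ⟨π, fun j => ?_, ?_, fun j S hS => ?_⟩
  · have : π j * π j = (n : K)⁻¹ • ∑ i ∈ Finset.range n, z j ^ (i + 1) • (T ^ (i + 1) * π j) := by
      conv_lhs => enter [1]; simp only [π]
      rw [smul_mul_assoc, Finset.sum_mul]
      simp only [smul_mul_assoc]
    rw [this]
    have : ∀ i, z j ^ (i + 1) • (T ^ (i + 1) * π j) = π j := by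
      intro i
      rw [h2, smul_smul, ← mul_pow, hz]
      simp [inv_mul_cancel₀ (pow_ne_zero j hζ0)]
    simp only [this, Finset.sum_const, Finset.card_range]
    rw [← Nat.cast_smul_eq_nsmul K, smul_smul, inv_mul_cancel₀ hn', one_smul]
  · have : ∑ j ∈ Finset.range n, ζ ^ j • π j =
        (n : K)⁻¹ • ∑ i ∈ Finset.range n, (∑ j ∈ Finset.range n, (ζ⁻¹ ^ i) ^ j) • T ^ (i + 1) := by
      simp only [π]
      simp_rw [smul_comm _ (n : K)⁻¹]
      rw [← Finset.smul_sum]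
      congr 1
      simp_rw [Finset.smul_sum, Finset.sum_smul]
      rw [Finset.sum_comm]
      refine Finset.sum_congr rfl fun i _ => Finset.sum_congr rfl fun j _ => ?_
      rw [smul_smul, pow_succ', hz, mul_inv_cancel_left₀ (pow_ne_zero _ hζ0)]
      congr 1
      rw [← pow_mul, inv_pow, inv_pow, ← pow_mul, mul_comm]
    rw [this, Finset.sum_eq_single 0]
    · simp only [pow_zero, one_pow, Finset.sum_const, Finset.card_range, nsmul_eq_mul, mul_one]
      rw [smul_smul, inv_mul_cancel₀ hn', one_smul, zero_add, pow_one]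
    · intro i hi hi0
      have hw : ζ⁻¹ ^ i ≠ 1 := hζ.inv.pow_ne_one_of_pos_of_lt hi0 (Finset.mem_range.1 hi)
      have := mul_geom_sum (ζ⁻¹ ^ i) n
      rw [← pow_mul, mul_comm i n, pow_mul, hζ.inv.pow_eq_one, one_pow, sub_self] at this
      rw [(mul_eq_zero.1 this).resolve_left (sub_ne_zero.2 hw), zero_smul]
    · intro h
      exact absurd (Finset.mem_range.2 (Nat.pos_of_ne_zero hn)) h
  · exact ((Commute.sum_right _ _ _ fun i _ => (hS.pow_right _).smul_right _)).smul_right _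

theorem trace_of_idempotent {K V : Type*} [Field K] [AddCommGroup V] [Module K V]
    [FiniteDimensional K V] {π : Module.End K V} (h : π * π = π) :
    ∃ r : ℕ, LinearMap.trace K V π = r :=
  ⟨_, (LinearMap.IsIdempotentElem.isProj_range π h).trace⟩

/-- If the group algebra of a cyclic group of order `n` is split, then the field contains the `n`-th
roots of unity. -/
theorem exists_isPrimitiveRoot_of_split {K : Type u} [Field K] [CharZero K] {G : Type v} [Group G]
    [Finite G] (s : G) (hsplit : IsSplitGroupAlgebra K (Subgroup.zpowers s)) :
    ∃ ζ : K, IsPrimitiveRoot ζ (orderOf s) := by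
  set n := orderOf s with hn
  have hn0 : n ≠ 0 := (orderOf_pos s).ne'
  have : NeZero n := ⟨hn0⟩
  let L := CyclotomicField n K
  have : FiniteDimensional K L := IsCyclotomicExtension.finite_of_singleton n K L
  let ζ : L := IsCyclotomicExtension.zeta n K L
  have hζ : IsPrimitiveRoot ζ n := IsCyclotomicExtension.zeta_spec n K L
  let g : Subgroup.zpowers s := ⟨s, Subgroup.mem_zpowers s⟩
  have hg : ∀ x, x ∈ Subgroup.zpowers g := by
    rintro ⟨x, hx⟩
    obtain ⟨i, rfl⟩ := Subgroup.mem_zpowers_iff.1 hx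
    exact Subgroup.mem_zpowers_iff.2 ⟨i, Subtype.ext (by simp [g])⟩
  have ho : orderOf g = n := by rw [hn]; exact Subgroup.orderOf_mk s _
  let z : Lˣ := hζ.isUnit hn0 |>.unit
  have hz : orderOf z ∣ orderOf g := by
    rw [ho]
    refine orderOf_dvd_of_pow_eq_one (Units.ext ?_)
    simpa [z] using hζ.pow_eq_one
  let f : Subgroup.zpowers s →* Lˣ := monoidHomOfForallMemZpowers hg hz
  have hf : f g = z := monoidHomOfForallMemZpowers_apply_gen hg hz
  -- The generator acts on `L = K(ζ)` by multiplication by `ζ`. Subrepresentations are stable under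
  -- `K[ζ] = L`, so `ρ` is irreducible. Multiplication by `ζ` is an endomorphism of it, and
  -- splitness forces `ζ ∈ K`.
  let ρ : Representation K (Subgroup.zpowers s) L :=
    ((Algebra.lmul K L).toRingHom.toMonoidHom.comp (Units.coeHom L)).comp f
  have hρ : ∀ x l, ρ x l = f x * l := fun _ _ => rfl
  have hirr : ρ.IsIrreducible := by
    refine { exists_pair_ne := ⟨⊥, ⊤, fun h => ?_⟩, eq_bot_or_eq_top := fun W => ?_ }
    · have := congrArg Subrepresentation.toSubmodule h
      exact bot_ne_top (α := Submodule K L) this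
    · by_cases hW : W.toSubmodule = ⊥
      · exact .inl (Subrepresentation.toSubmodule_injective hW)
      · refine .inr (Subrepresentation.toSubmodule_injective ?_)
        obtain ⟨w, hw, hw0⟩ := Submodule.exists_mem_ne_zero_of_ne_bot hW
        have key : ∀ l : L, ∀ x ∈ W.toSubmodule, l * x ∈ W.toSubmodule := by
          intro l
          have hl : l ∈ Algebra.adjoin K {ζ} := by
            rw [IsCyclotomicExtension.adjoin_primitive_root_eq_top hζ]
            trivial
          induction hl using Algebra.adjoin_induction with
          | mem y hy =>
            rintro x hx
            obtain rfl : y = ζ := hy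
            have := W.apply_mem_toSubmodule g hx
            rw [hρ, hf] at this
            exact this
          | algebraMap r =>
            intro x hx
            rw [← Algebra.smul_def]
            exact W.toSubmodule.smul_mem r hx
          | add a b _ _ ha hb =>
            intro x hx
            rw [add_mul]
            exact W.toSubmodule.add_mem (ha x hx) (hb x hx)
          | mul a b _ _ ha hb =>
            intro x hx
            rw [mul_assoc]
            exact ha _ (hb x hx)
        refine eq_top_iff.2 fun l _ => ?_
        have := key (l * w⁻¹) w hw
        rwa [inv_mul_cancel_right₀ hw0] at this
  obtain ⟨c, hc⟩ := hsplit L ρ hirr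
    ⟨Algebra.lmul K L ζ, fun x => LinearMap.ext fun l => by
      simp [hρ, mul_left_comm]⟩
  refine ⟨c, IsPrimitiveRoot.of_map_of_injective (f := algebraMap K L) ?_ (algebraMap K L).injective⟩
  have : ζ = algebraMap K L c := by
    have := LinearMap.congr_fun hc 1
    simpa [Algebra.smul_def] using this
  rwa [← this]

/-! ### Traces on fibres -/

namespace Bundle

variable {K : Type u} {G : Type v} [Field K] [Group G] [Fintype G]

/-- The operator `ρ x` carries the fibre at `a` into another fibre, so cyclicity of the trace gives
0. -/
theorem fiberTrace_eq_zero (E : Bundle K G) {a x : G} (h : x * a * x⁻¹ ≠ a) :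
    E.fiberTrace a x = 0 := by
  have h1 : E.ρ x ∘ₗ E.proj a = E.ρ x ∘ₗ E.proj a ∘ₗ E.proj a := by
    ext v; simp [E.proj_self]
  have h2 : E.proj a ∘ₗ E.ρ x ∘ₗ E.proj a = 0 := by
    ext v; simp [E.ρ_proj, E.proj_ne _ _ h.symm]
  rw [fiberTrace, h1, ← LinearMap.comp_assoc, LinearMap.trace_comp_comm', h2, map_zero]

/-- Fibre traces turn the product of bundles into convolution; this makes the map to the group
algebra multiplicative. -/
theorem fiberTrace_tensor (E F : Bundle K G) {c x : G} :
    (tensor E F).fiberTrace c x = ∑ a, E.fiberTrace a x * F.fiberTrace (a⁻¹ * c) x := by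
  have : (tensor E F).ρ x ∘ₗ (tensor E F).proj c =
      ∑ a, TensorProduct.map (E.ρ x ∘ₗ E.proj a) (F.ρ x ∘ₗ F.proj (a⁻¹ * c)) := by
    change (E.ρ.tprod F.ρ) x ∘ₗ tensorProj E F c = _
    refine TensorProduct.ext' fun v w => ?_
    simp [tensorProj_tmul, LinearMap.sum_apply]
  rw [fiberTrace, this]
  change LinearMap.trace K (E.V ⊗[K] F.V) _ = _
  rw [map_sum]
  refine Finset.sum_congr rfl fun a _ => ?_
  exact LinearMap.trace_tensorProduct' _ _

open Classical in
theorem fiberTrace_one (a x : G) : (one : Bundle K G).fiberTrace a x = if a = 1 then 1 else 0 := by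
  change LinearMap.trace K K (Representation.trivial K G K x ∘ₗ
    (if a = 1 then LinearMap.id else (0 : K →ₗ[K] K))) = _
  split_ifs
  · have : Representation.trivial K G K x ∘ₗ LinearMap.id = LinearMap.id := by ext; simp
    rw [this, LinearMap.trace_id]
    simp
  · simp

/-- The two factors commute. The exponent is `orderOf x + 1` because the operator vanishes off the
fibre at `a`: its power of exponent `orderOf x` is `proj a`, not the identity. -/
theorem pow_succ_comp_proj (E : Bundle K G) {a x : G} (h : x * a * x⁻¹ = a) :
    (E.ρ x * E.proj a) ^ (orderOf x + 1) = E.ρ x * E.proj a := by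
  have hc : Commute (E.ρ x) (E.proj a) := by
    ext v
    simp [E.ρ_proj, h]
  have hp : IsIdempotentElem (E.proj a) := by
    ext v
    simp [E.proj_self]
  rw [hc.mul_pow, hp.pow_succ_eq, ← map_pow, pow_succ, pow_orderOf_eq_one, one_mul]

/-- The trace is a sum of powers of `ζ` with natural number multiplicities, the ranks of the
spectral projectors. -/
theorem isIntegral_fiberTrace [CharZero K] {R : Type*} [CommRing R] [Algebra R K]
    (E : Bundle K G) (a x : G) {ζ : K} (hζ : IsPrimitiveRoot ζ (orderOf x)) :
    IsIntegral R (E.fiberTrace a x) := by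
  by_cases h : x * a * x⁻¹ = a
  · obtain ⟨π, h1, h2, -⟩ := exists_idempotents_of_pow_succ_eq (orderOf_pos x).ne' hζ _
      (E.pow_succ_comp_proj h)
    have hζi : IsIntegral R ζ := IsIntegral.of_pow (orderOf_pos x)
      (by rw [hζ.pow_eq_one]; exact isIntegral_one)
    change IsIntegral R (LinearMap.trace K E.V (E.ρ x * E.proj a))
    rw [h2, map_sum]
    refine IsIntegral.sum _ fun j _ => ?_
    obtain ⟨r, hr⟩ := trace_of_idempotent (h1 j)
    rw [map_smul, hr, smul_eq_mul]
    refine (hζi.pow j).mul ?_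
    simpa using isIntegral_algebraMap (R := R) (A := K) (x := (r : R))
  · rw [E.fiberTrace_eq_zero h]
    exact isIntegral_zero

end Bundle

/-! ### Central elements of group algebras -/

/-- The central element of the group algebra given by a class function. -/
def centralOfClassFun {D H : Type*} [CommRing D] [Group H] [Finite H] (φ : H → D)
    (hφ : ∀ x a, φ (x * a * x⁻¹) = φ a) : Subalgebra.center D (MonoidAlgebra D H) :=
  ⟨.ofCoeff (Finsupp.equivFunOnFinite.symm φ), by
    rw [Subalgebra.mem_center_iff]
    intro y
    induction y using MonoidAlgebra.induction_linear with
    | zero => simp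
    | add x y hx hy => rw [add_mul, mul_add, hx, hy]
    | single h c =>
      ext a
      rw [MonoidAlgebra.coeff_single_mul_apply, MonoidAlgebra.coeff_mul_single_apply, mul_comm c]
      congr 1
      simp only [Finsupp.coe_equivFunOnFinite_symm]
      rw [← hφ h]
      congr 1
      group⟩

theorem coeff_conj_of_mem_center {D H : Type*} [CommRing D] [Group H]
    (z : Subalgebra.center D (MonoidAlgebra D H)) (x a : H) :
    z.1.coeff (x * a * x⁻¹) = z.1.coeff a := by
  have := congrArg (fun y => y.coeff (x * a))
    (Subalgebra.mem_center_iff.1 z.2 (MonoidAlgebra.single x 1))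
  rw [MonoidAlgebra.coeff_single_mul_apply, MonoidAlgebra.coeff_mul_single_apply] at this
  simpa using this.symm

theorem center_ext {D H : Type*} [CommRing D] [Group H]
    {y z : Subalgebra.center D (MonoidAlgebra D H)} (h : ∀ a, y.1.coeff a = z.1.coeff a) : y = z :=
  Subtype.ext (MonoidAlgebra.ext (Finsupp.ext h))

/-! ### The homomorphism from the Grothendieck ring to the centre of a group algebra -/

section Lift

variable {K : Type u} [Field K] {G : Type v} [Group G] [Fintype G]

/-- The homomorphism from the Grothendieck ring given by a multiplicative and additive function on
isomorphism classes of bundles. -/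
def GrothendieckRing.lift {R : Type*} [CommRing R] (m : BundleClass K G →* R)
    (hm : ∀ E F : Bundle K G, m (BundleClass.mk (E.sum F)) =
      m (BundleClass.mk E) + m (BundleClass.mk F)) : GrothendieckRing K G →+* R :=
  Ideal.Quotient.lift _ (FreeAbelianGroup.liftMonoid m) (by
    intro r hr
    have hle : Ideal.span (sumRelations K G) ≤ RingHom.ker (FreeAbelianGroup.liftMonoid m) := by
      refine Ideal.span_le.2 ?_
      rintro _ ⟨E, F, rfl⟩
      have key : ∀ c, FreeAbelianGroup.liftMonoid m (FreeAbelianGroup.of c) = m c := fun c =>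
        FreeAbelianGroup.lift_apply_of _ c
      rw [SetLike.mem_coe, RingHom.mem_ker, map_sub, map_sub, key, key, key, hm, sub_sub, sub_self]
    exact hle hr)

theorem GrothendieckRing.lift_bundleClass {R : Type*} [CommRing R] (m : BundleClass K G →* R)
    (hm : ∀ E F : Bundle K G, m (BundleClass.mk (E.sum F)) =
      m (BundleClass.mk E) + m (BundleClass.mk F)) (E : Bundle K G) :
    GrothendieckRing.lift m hm (bundleClass E) = m (BundleClass.mk E) :=
  FreeAbelianGroup.lift_apply_of (m : BundleClass K G → R) _

/-- The extension of `GrothendieckRing.lift` to coefficients in `D`. -/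
def GrothendieckRing.liftAlgHom (D : Type*) [CommRing D] {R : Type*} [CommRing R] [Algebra D R]
    (m : BundleClass K G →* R) (hm : ∀ E F : Bundle K G, m (BundleClass.mk (E.sum F)) =
      m (BundleClass.mk E) + m (BundleClass.mk F)) : D ⊗[ℤ] GrothendieckRing K G →ₐ[D] R :=
  Algebra.TensorProduct.lift (Algebra.ofId D R)
    { GrothendieckRing.lift m hm with commutes' := fun n => by simp } fun _ _ => Commute.all _ _

theorem GrothendieckRing.liftAlgHom_tmul (D : Type*) [CommRing D] {R : Type*} [CommRing R]
    [Algebra D R] (m : BundleClass K G →* R)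
    (hm : ∀ E F : Bundle K G, m (BundleClass.mk (E.sum F)) =
      m (BundleClass.mk E) + m (BundleClass.mk F)) (r : D) (E : Bundle K G) :
    GrothendieckRing.liftAlgHom D m hm (r ⊗ₜ bundleClass E) = r • m (BundleClass.mk E) := by
  rw [liftAlgHom, Algebra.TensorProduct.lift_tmul, Algebra.smul_def]
  exact congrArg _ (lift_bundleClass m hm E)

/-- No hypothesis for negatives is needed: the sign of `-[E]` is absorbed into the coefficient. -/
theorem GrothendieckRing.tmul_induction {D : Type*} [CommRing D]
    {P : D ⊗[ℤ] GrothendieckRing K G → Prop} (h : ∀ r E, P (r ⊗ₜ bundleClass E))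
    (hadd : ∀ x y, P x → P y → P (x + y)) (x : D ⊗[ℤ] GrothendieckRing K G) : P x := by
  have h0 : P 0 := by
    have := h 0 Bundle.one
    rwa [TensorProduct.zero_tmul] at this
  induction x using TensorProduct.induction_on with
  | zero => exact h0
  | add x y hx hy => exact hadd x y hx hy
  | tmul r c =>
    obtain ⟨c, rfl⟩ := Ideal.Quotient.mk_surjective c
    induction c using FreeAbelianGroup.induction_on generalizing r with
    | zero => rw [map_zero, TensorProduct.tmul_zero]; exact h0
    | of c =>
      induction c using BundleClass.ind with
      | h E => exact h r E
    | neg c hc =>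
      rw [map_neg, TensorProduct.tmul_neg, ← TensorProduct.neg_tmul]
      exact hc (-r)
    | add c d hc hd =>
      rw [map_add, TensorProduct.tmul_add]
      exact hadd _ _ (hc r) (hd r)

end Lift

section FiberTraceHom

variable {K : Type u} [Field K] {G : Type v} [Group G] [Fintype G] (D : Type*) [CommRing D]
  [Algebra D K] (hD : Function.Injective (algebraMap D K)) (s : G)
  (hs : ∀ a (c : BundleClass K G), ∃ d : D, algebraMap D K d = BundleClass.fiberTrace a s c)

/-- The element `∑ a, tr(s | E_a) a` of the centre of `D C_G(s)`, where `D` is a subring that contains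
the traces of `s`. -/
def classToCenter (c : BundleClass K G) :
    Subalgebra.center D (MonoidAlgebra D (Subgroup.centralizer {s})) :=
  centralOfClassFun (fun a => (hs a c).choose) (by
    intro x a
    refine hD ?_
    rw [(hs _ c).choose_spec, (hs _ c).choose_spec]
    induction c using BundleClass.ind with
    | h E =>
      have := E.fiberTrace_conj a s x
      rw [Subgroup.mem_centralizer_singleton_iff.1 x.2, mul_inv_cancel_right] at this
      exact this)

theorem coeff_classToCenter_mk (E : Bundle K G) (a : Subgroup.centralizer {s}) :
    algebraMap D K ((classToCenter D hD s hs (BundleClass.mk E)).1.coeff a) = E.fiberTrace a s :=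
  (hs a (BundleClass.mk E)).choose_spec

/-- The map `classToCenter` as a homomorphism of monoids. -/
def classToCenterHom :
    BundleClass K G →* Subalgebra.center D (MonoidAlgebra D (Subgroup.centralizer {s})) where
  toFun := classToCenter D hD s hs
  map_one' := by
    classical
    refine center_ext fun a => hD ?_
    refine (coeff_classToCenter_mk D hD s hs Bundle.one a).trans ?_
    rw [Bundle.fiberTrace_one, OneMemClass.coe_one, MonoidAlgebra.one_def,
      MonoidAlgebra.coeff_single, Finsupp.single_apply]
    simp only [OneMemClass.coe_eq_one, eq_comm (a := (1 : Subgroup.centralizer {s}))]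
    split_ifs <;> simp
  map_mul' c d := by
    classical
    refine center_ext fun a => hD ?_
    induction c using BundleClass.ind with
    | h E =>
    induction d using BundleClass.ind with
    | h F =>
      rw [BundleClass.mk_mul, coeff_classToCenter_mk, Bundle.fiberTrace_tensor, MulMemClass.coe_mul,
        MonoidAlgebra.coeff_mul_apply_left, Finsupp.sum_fintype _ _ (by simp)]
      simp only [map_sum, map_mul, coeff_classToCenter_mk]
      -- The convolution of bundles runs over all of `G`, the product in the group algebra over
      -- `C_G(s)` only. The additional terms vanish since `s` moves those fibres.
      have hsub := Finset.sum_subtype (F := Fintype.ofFinite _)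
        ({a | a ∈ Subgroup.centralizer {s}} : Finset G) (p := (· ∈ Subgroup.centralizer {s}))
        (by simp) fun b => E.fiberTrace b s * F.fiberTrace (b⁻¹ * a) s
      refine Eq.trans ?_ (hsub.trans (Finset.sum_congr (by ext; simp) fun _ _ => rfl))
      refine (Finset.sum_filter_of_ne fun b _ hb => ?_).symm
      by_contra hn
      refine hb ?_
      rw [E.fiberTrace_eq_zero, zero_mul]
      intro h
      refine hn (mem_centralizer_iff'.2 ?_)
      rwa [mul_inv_eq_iff_eq_mul] at h

/-- The extension of `classToCenter` to a homomorphism of `D`-algebras. -/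
def toCenterAlgHom : D ⊗[ℤ] GrothendieckRing K G →ₐ[D]
    Subalgebra.center D (MonoidAlgebra D (Subgroup.centralizer {s})) :=
  GrothendieckRing.liftAlgHom D (classToCenterHom D hD s hs)
    fun E F => center_ext fun a => hD (by
      have h1 := coeff_classToCenter_mk D hD s hs (E.sum F) a
      rw [E.fiberTrace_sum F] at h1
      rw [AddMemClass.coe_add, MonoidAlgebra.coeff_add, Finsupp.add_apply, map_add]
      exact h1.trans (congrArg₂ (· + ·) (coeff_classToCenter_mk D hD s hs E a).symm
        (coeff_classToCenter_mk D hD s hs F a).symm))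

theorem coeff_toCenterAlgHom_tmul (r : D) (E : Bundle K G) (a : Subgroup.centralizer {s}) :
    algebraMap D K ((toCenterAlgHom D hD s hs (r ⊗ₜ bundleClass E)).1.coeff a) =
      algebraMap D K r * E.fiberTrace a s := by
  rw [toCenterAlgHom, GrothendieckRing.liftAlgHom_tmul, ← coeff_classToCenter_mk D hD s hs E,
    ← map_mul]
  rfl

end FiberTraceHom

theorem exists_algebraMap_eq_fiberTrace (p : ℕ) [Fact p.Prime] {K : Type u} [Field K] [CharZero K]
    [Algebra ℤ_[p] K] {G : Type v} [Group G] [Fintype G] (s : G) {ζ : K}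
    (hζ : IsPrimitiveRoot ζ (orderOf s)) (a : G) (c : BundleClass K G) :
    ∃ d : IntegersOver p K, algebraMap (IntegersOver p K) K d = BundleClass.fiberTrace a s c := by
  induction c using BundleClass.ind with
  | h E => exact ⟨⟨_, E.isIntegral_fiberTrace a s hζ⟩, rfl⟩

/-- The character `Ψ_{s, σ}` is the composition of the central character of `σ` with the
homomorphism to the centre of `𝒪 C_G(s)`. -/
theorem psi_eq_centralCharacter (p : ℕ) [Fact p.Prime] {K : Type u} [Field K]
    [Algebra ℤ_[p] K] {G : Type v} [Group G] [Fintype G] (s : G)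
    (hD : Function.Injective (algebraMap (IntegersOver p K) K))
    (hs : ∀ a (c : BundleClass K G), ∃ d : IntegersOver p K,
      algebraMap (IntegersOver p K) K d = BundleClass.fiberTrace a s c)
    (σ : Irr K (Subgroup.centralizer {s})) (hσ : σ.1 1 ≠ 0)
    (ω : Subalgebra.center (IntegersOver p K) (MonoidAlgebra (IntegersOver p K)
      (Subgroup.centralizer {s})) →ₐ[IntegersOver p K] IntegersOver p K)
    (hω : ∀ z, (ω z : K) * σ.1 1 = z.1.coeff.sum fun a c => (c : K) * σ.1 a)
    (e : IntegralGrothendieckRing p K G) :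
    psi ⟨s, σ⟩ (toFieldCoeff p K G e) = ω (toCenterAlgHom (IntegersOver p K) hD s hs e) := by
  classical
  induction e using GrothendieckRing.tmul_induction with
  | hadd x y hx hy => rw [map_add, map_add, hx, hy, map_add, map_add]; rfl
  | h r E =>
    refine mul_right_cancel₀ hσ ?_
    rw [hω, Finsupp.sum_fintype _ _ (by simp)]
    have hc := coeff_toCenterAlgHom_tmul (IntegersOver p K) hD s hs r E
    simp only [Subalgebra.algebraMap_apply] at hc
    simp only [hc]
    have : psi (⟨s, σ⟩ : IrrPairs K G) (toFieldCoeff p K G (r ⊗ₜ bundleClass E)) =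
        (r : K) * psiHom ⟨s, σ⟩ (bundleClass E) := rfl
    rw [this, psiHom_bundleClass, Finset.mul_sum, Finset.mul_sum, Finset.sum_mul]
    refine Finset.sum_congr rfl fun a _ => ?_
    field_simp

/-! ### Sub-bundles, Maschke's theorem, and finite generation of the Grothendieck ring -/

section

variable {K : Type u} {G : Type v} [Field K] [Group G] [Fintype G]

theorem bundleClass_eq_of_iso {E F : Bundle K G} (h : Bundle.Iso E F) :
    bundleClass E = bundleClass F :=
  congrArg (fun c => Ideal.Quotient.mk (Ideal.span (sumRelations K G)) (FreeAbelianGroup.of c))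
    (Quotient.sound h : BundleClass.mk E = BundleClass.mk F)

theorem bundleClass_sum (E F : Bundle K G) :
    bundleClass (E.sum F) = bundleClass E + bundleClass F := by
  have : FreeAbelianGroup.of (BundleClass.mk (E.sum F)) - FreeAbelianGroup.of (BundleClass.mk E) -
      FreeAbelianGroup.of (BundleClass.mk F) ∈ Ideal.span (sumRelations K G) :=
    Ideal.subset_span ⟨E, F, rfl⟩
  have := Ideal.Quotient.eq_zero_iff_mem.2 this
  rw [map_sub, map_sub, sub_sub, sub_eq_zero] at this
  exact this

namespace Bundle

/-- A subspace of a bundle that is stable under `G` and homogeneous. -/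
def IsStable (E : Bundle K G) (W : Submodule K E.V) : Prop :=
  (∀ x, ∀ w ∈ W, E.ρ x w ∈ W) ∧ ∀ a, ∀ w ∈ W, E.proj a w ∈ W

/-- The bundle with total space a stable subspace. -/
def sub (E : Bundle K G) (W : Submodule K E.V) (h : E.IsStable W) : Bundle K G where
  V := W
  ρ :=
    { toFun := fun x => (E.ρ x).restrict (h.1 x)
      map_one' := by ext; simp
      map_mul' := fun x y => by ext; simp }
  proj a := (E.proj a).restrict (h.2 a)
  proj_self a v := Subtype.ext (E.proj_self a v)
  proj_ne a b hab v := Subtype.ext (E.proj_ne a b hab v)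
  sum_proj v := Subtype.ext (by simpa using E.sum_proj v)
  ρ_proj x a v := Subtype.ext (E.ρ_proj x a v)

/-- Homomorphisms of bundles. -/
def IsHom (E F : Bundle K G) (φ : E.V →ₗ[K] F.V) : Prop :=
  (∀ x v, φ (E.ρ x v) = F.ρ x (φ v)) ∧ ∀ a v, φ (E.proj a v) = F.proj a (φ v)

theorem IsHom.isStable_ker {E F : Bundle K G} {φ : E.V →ₗ[K] F.V} (h : IsHom E F φ) :
    E.IsStable (LinearMap.ker φ) := by
  refine ⟨fun x w hw => ?_, fun a w hw => ?_⟩ <;> rw [LinearMap.mem_ker] at *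
  · rw [h.1, hw, map_zero]
  · rw [h.2, hw, map_zero]

theorem IsHom.isStable_range {E F : Bundle K G} {φ : E.V →ₗ[K] F.V} (h : IsHom E F φ) :
    F.IsStable (LinearMap.range φ) := by
  refine ⟨?_, ?_⟩
  · rintro x _ ⟨v, rfl⟩
    exact ⟨_, h.1 x v⟩
  · rintro a _ ⟨v, rfl⟩
    exact ⟨_, h.2 a v⟩

theorem iso_sum_of_isCompl (E : Bundle K G) {W C : Submodule K E.V} (hW : E.IsStable W)
    (hC : E.IsStable C) (h : IsCompl W C) : Iso ((E.sub W hW).sum (E.sub C hC)) E := by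
  refine ⟨Submodule.prodEquivOfIsCompl W C h, ?_, ?_⟩
  · rintro x ⟨v, w⟩
    change (E.ρ x v.1 + E.ρ x w.1 : E.V) = E.ρ x (v.1 + w.1)
    rw [map_add]
  · rintro a ⟨v, w⟩
    change (E.proj a v.1 + E.proj a w.1 : E.V) = E.proj a (v.1 + w.1)
    rw [map_add]

/-- Factor `π` through its range and use cyclicity of the trace. Traces on eigen-sub-bundles become
traces on `E`, where they can be added up. -/
theorem fiberTrace_sub_range (E : Bundle K G) {π : Module.End K E.V} (hπ : π * π = π)
    (h : E.IsStable (LinearMap.range π)) (a x : G) :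
    (E.sub _ h).fiberTrace a x = LinearMap.trace K E.V (E.ρ x * E.proj a * π) := by
  let ι := (LinearMap.range π).subtype
  have h1 : π.rangeRestrict ∘ₗ (E.ρ x ∘ₗ E.proj a ∘ₗ ι) =
      (E.sub _ h).ρ x ∘ₗ (E.sub _ h).proj a := by
    refine LinearMap.ext fun w => Subtype.ext ?_
    obtain ⟨v, hv⟩ := (h.1 x _ (h.2 a _ w.2) : E.ρ x (E.proj a w.1) ∈ LinearMap.range π)
    change π (E.ρ x (E.proj a w.1)) = E.ρ x (E.proj a w.1)
    rw [← hv]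
    exact LinearMap.congr_fun hπ v
  rw [fiberTrace, ← h1]
  change LinearMap.trace K (LinearMap.range π) _ = _
  rw [LinearMap.trace_comp_comm']
  rfl

/-- Maschke's theorem for bundles. -/
theorem exists_isCompl [CharZero K] (E : Bundle K G) {W : Submodule K E.V} (hW : E.IsStable W) :
    ∃ C, E.IsStable C ∧ IsCompl W C := by
  classical
  obtain ⟨f, hf⟩ := W.subtype.exists_leftInverse_of_injective (by simp)
  have hf' : ∀ w ∈ W, (f w : E.V) = w := fun w hw =>
    congrArg Subtype.val (LinearMap.congr_fun hf ⟨w, hw⟩)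
  -- Replacing the linear projection `f` by its diagonal part makes it homogeneous. Averaging over
  -- `G` then makes it equivariant and keeps it homogeneous, as `G` permutes the fibres.
  let g : E.V → E.V := fun v => ∑ a, E.proj a (f (E.proj a v))
  let q : E.V →ₗ[K] E.V := (Fintype.card G : K)⁻¹ •
    ∑ x : G, E.ρ x ∘ₗ (∑ a, E.proj a ∘ₗ W.subtype ∘ₗ f ∘ₗ E.proj a) ∘ₗ E.ρ x⁻¹
  have hq : ∀ v, q v = (Fintype.card G : K)⁻¹ • ∑ x : G, E.ρ x (g (E.ρ x⁻¹ v)) := by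
    intro v
    simp [q, g, LinearMap.sum_apply]
  have hgW : ∀ v, g v ∈ W := fun v => W.sum_mem fun a _ => hW.2 a _ (f _).2
  have hg1 : ∀ w ∈ W, g w = w := by
    intro w hw
    simp only [g]
    conv_rhs => rw [← E.sum_proj w]
    refine Finset.sum_congr rfl fun a _ => ?_
    rw [hf' _ (hW.2 a w hw), E.proj_self]
  have hg2 : ∀ b v, g (E.proj b v) = E.proj b (g v) := by
    intro b v
    simp only [g, map_sum]
    refine Finset.sum_congr rfl fun a _ => ?_
    rw [E.proj_proj, E.proj_proj]
    by_cases h : a = b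
    · simp [h]
    · simp [h, Ne.symm h]
  have hcard : (Fintype.card G : K) ≠ 0 := Nat.cast_ne_zero.2 Fintype.card_ne_zero
  have hinv : ∀ x v, E.ρ x⁻¹ (E.ρ x v) = v := fun x v => by
    rw [← Module.End.mul_apply, ← map_mul]; simp
  have hinv' : ∀ x v, E.ρ x (E.ρ x⁻¹ v) = v := fun x v => by
    rw [← Module.End.mul_apply, ← map_mul]; simp
  have hproj : LinearMap.IsProj W q := by
    refine ⟨fun v => ?_, fun w hw => ?_⟩
    · rw [hq]
      exact W.smul_mem _ (W.sum_mem fun x _ => hW.1 x _ (hgW _))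
    · rw [hq]
      have : ∀ x : G, E.ρ x (g (E.ρ x⁻¹ w)) = w := fun x => by
        rw [hg1 _ (hW.1 _ w hw), hinv']
      simp only [this, Finset.sum_const, Finset.card_univ]
      rw [← Nat.cast_smul_eq_nsmul K, smul_smul, inv_mul_cancel₀ hcard, one_smul]
  have hhom : IsHom E E q := by
    refine ⟨fun y v => ?_, fun b v => ?_⟩
    · rw [hq, hq, map_smul, map_sum]
      congr 1
      refine Fintype.sum_equiv (Equiv.mulLeft y⁻¹) _ _ fun x => ?_
      simp only [Equiv.coe_mulLeft]
      rw [← Module.End.mul_apply (E.ρ y), ← map_mul, mul_inv_cancel_left, mul_inv_rev, inv_inv,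
        map_mul, Module.End.mul_apply]
    · rw [hq, hq, map_smul, map_sum]
      congr 1
      refine Finset.sum_congr rfl fun x _ => ?_
      rw [E.ρ_proj, hg2, E.ρ_proj]
      congr 1
      group
  exact ⟨_, hhom.isStable_ker, hproj.isCompl⟩

/-- A bundle is simple if it is nonzero and has no proper nonzero stable subspaces. -/
def IsSimple (E : Bundle K G) : Prop :=
  Nontrivial E.V ∧ ∀ W, E.IsStable W → W = ⊥ ∨ W = ⊤

/-- Complete reducibility, as an induction on the dimension. The zero bundle is a separate case
since it is not simple. -/
theorem induction_simple [CharZero K] {P : Bundle K G → Prop}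
    (zero : ∀ E : Bundle K G, Subsingleton E.V → P E) (simple : ∀ E : Bundle K G, E.IsSimple → P E)
    (sum : ∀ E F, P E → P F → P (E.sum F)) (iso : ∀ E F, Iso E F → P E → P F)
    (E : Bundle K G) : P E := by
  induction hn : Module.finrank K E.V using Nat.strong_induction_on generalizing E with
  | _ n ih =>
    by_cases h0 : Subsingleton E.V
    · exact zero E h0
    by_cases hs : E.IsSimple
    · exact simple E hs
    rw [not_subsingleton_iff_nontrivial] at h0
    obtain ⟨W, hW, hb, ht⟩ : ∃ W, E.IsStable W ∧ W ≠ ⊥ ∧ W ≠ ⊤ := by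
      by_contra! h
      refine hs ⟨h0, fun W hW => ?_⟩
      by_cases hb : W = ⊥
      · exact .inl hb
      · exact .inr (h W hW hb)
    obtain ⟨C, hC, hc⟩ := E.exists_isCompl hW
    have hC' : C ≠ ⊤ := fun h => hb (by simpa [h] using hc.disjoint)
    refine iso _ _ (E.iso_sum_of_isCompl hW hC hc) (sum _ _ ?_ ?_)
    · exact ih _ (hn ▸ Submodule.finrank_lt ht) (E.sub W hW) rfl
    · exact ih _ (hn ▸ Submodule.finrank_lt hC') (E.sub C hC) rfl

/-- Schur's lemma: the kernel and the range are stable. -/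
theorem IsSimple.iso_of_isHom {E F : Bundle K G} (hE : E.IsSimple) (hF : F.IsSimple)
    {φ : E.V →ₗ[K] F.V} (h : IsHom E F φ) (h0 : φ ≠ 0) : Iso E F := by
  have hk : LinearMap.ker φ = ⊥ := (hE.2 _ h.isStable_ker).resolve_right
    fun h' => h0 (LinearMap.ker_eq_top.1 h')
  have hr : LinearMap.range φ = ⊤ := (hF.2 _ h.isStable_range).resolve_left
    fun h' => h0 (LinearMap.range_eq_bot.1 h')
  exact ⟨LinearEquiv.ofBijective φ ⟨LinearMap.ker_eq_bot.1 hk, LinearMap.range_eq_top.1 hr⟩,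
    h.1, h.2⟩

/-- A nonzero homomorphism from a direct sum is nonzero on a summand. Complete reducibility reduces
to simple `E`, where Schur's lemma leaves only `E` itself. -/
theorem exists_finite_quotients [CharZero K] (E : Bundle K G) : ∃ S : Set (Bundle K G), S.Finite ∧
    ∀ F : Bundle K G, F.IsSimple → ∀ φ, IsHom E F φ → φ ≠ 0 → ∃ F' ∈ S, Iso F' F := by
  induction E using induction_simple with
  | zero E h => exact ⟨∅, Set.finite_empty, fun F _ φ _ h0 => absurd (Subsingleton.elim _ _) h0⟩
  | simple E h =>
    exact ⟨{E}, Set.finite_singleton E, fun F hF φ hφ h0 => ⟨E, rfl, h.iso_of_isHom hF hφ h0⟩⟩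
  | sum E F hE hF =>
    obtain ⟨S, hS, hS'⟩ := hE
    obtain ⟨T, hT, hT'⟩ := hF
    refine ⟨S ∪ T, hS.union hT, fun H hH φ hφ h0 => ?_⟩
    by_cases h1 : φ ∘ₗ LinearMap.inl K E.V F.V = 0
    · have h2 : φ ∘ₗ LinearMap.inr K E.V F.V ≠ 0 := fun h2 =>
        h0 (LinearMap.prod_ext (h1.trans (LinearMap.zero_comp _).symm)
          (h2.trans (LinearMap.zero_comp _).symm))
      obtain ⟨F', h, h'⟩ := hT' H hH _ ⟨fun x v => by
        refine Eq.trans (congrArg φ ?_) (hφ.1 x (0, v))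
        exact Prod.ext (map_zero (E.ρ x)).symm rfl, fun a v => by
        refine Eq.trans (congrArg φ ?_) (hφ.2 a (0, v))
        exact Prod.ext (map_zero (E.proj a)).symm rfl⟩ h2
      exact ⟨F', .inr h, h'⟩
    · obtain ⟨F', h, h'⟩ := hS' H hH _ ⟨fun x v => by
        refine Eq.trans (congrArg φ ?_) (hφ.1 x (v, 0))
        exact Prod.ext rfl (map_zero (F.ρ x)).symm, fun a v => by
        refine Eq.trans (congrArg φ ?_) (hφ.2 a (v, 0))
        exact Prod.ext rfl (map_zero (F.proj a)).symm⟩ h1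
      exact ⟨F', .inl h, h'⟩
  | iso E F h hE =>
    obtain ⟨ψ, h1, h2⟩ := h
    obtain ⟨S, hS, hS'⟩ := hE
    refine ⟨S, hS, fun H hH φ hφ h0 => hS' H hH (φ ∘ₗ ψ.toLinearMap) ⟨fun x v => ?_, fun a v => ?_⟩
      fun h => h0 ?_⟩
    · simp [h1, hφ.1]
    · simp [h2, hφ.2]
    · ext v
      simpa using LinearMap.congr_fun h (ψ.symm v)

/-! ### The regular bundles -/

variable (K) in
/-- The permutation operator `f ↦ f ∘ σ` on functions on a finite set. -/
abbrev permOp {G : Type*} [Fintype G] (σ : Equiv.Perm G) :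
    Module.End K (Fin (Fintype.card G) → K) :=
  LinearMap.funLeft K K fun i => Fintype.equivFin G (σ ((Fintype.equivFin G).symm i))

variable (K) in
open Classical in
/-- The bundle of functions on `G`, where `G` acts by left translation and the fibre at `a` is the
space of the functions that vanish at all `x` with `x h x⁻¹ ≠ a`. -/
def regular (h : G) : Bundle K G where
  -- `G` is replaced by `Fin (Fintype.card G)` so that the total space lies in the universe of `K`.
  V := Fin (Fintype.card G) → K
  ρ :=
    { toFun := fun x => permOp K (Equiv.mulLeft x⁻¹)
      map_one' := by ext; simp [permOp]
      map_mul' := fun x y => by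
        refine LinearMap.ext fun f => funext fun i => ?_
        simp [permOp, LinearMap.funLeft_apply] }
  proj a :=
    { toFun := fun f i => if (Fintype.equivFin G).symm i * h * ((Fintype.equivFin G).symm i)⁻¹ = a
        then f i else 0
      map_add' := fun f g => by ext i; simp only [Pi.add_apply]; split_ifs <;> simp
      map_smul' := fun c f => by ext i; simp }
  proj_self a f := by ext i; simp +contextual
  proj_ne a b hab f := by
    ext i
    simp only [LinearMap.coe_mk, AddHom.coe_mk, Pi.zero_apply]
    split_ifs with h1 h2
    · exact absurd (h1.symm.trans h2) hab
    · rfl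
    · rfl
  sum_proj f := by ext i; simp
  ρ_proj x a f := by
    ext i
    simp only [LinearMap.coe_mk, AddHom.coe_mk, MonoidHom.coe_mk, OneHom.coe_mk, permOp,
      LinearMap.funLeft_apply, Equiv.symm_apply_apply, Equiv.coe_mulLeft]
    congr 1
    generalize (Fintype.equivFin G).symm i = y
    refine propext ⟨fun e => ?_, fun e => ?_⟩
    · rw [← e]; group
    · rw [show x⁻¹ * y * h * (x⁻¹ * y)⁻¹ = x⁻¹ * (y * h * y⁻¹) * x by group, e]; group

theorem permOp_apply {G : Type*} [Fintype G] (σ : Equiv.Perm G) (f : Fin (Fintype.card G) → K) (y : G) :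
    permOp K σ f (Fintype.equivFin G y) = f (Fintype.equivFin G (σ y)) := by
  simp [LinearMap.funLeft_apply]

theorem regular_ρ_apply (h x : G) (f : Fin (Fintype.card G) → K) (y : G) :
    ((regular K h).ρ x f : Fin (Fintype.card G) → K) (Fintype.equivFin G y) =
      f (Fintype.equivFin G (x⁻¹ * y)) :=
  permOp_apply (Equiv.mulLeft x⁻¹) f y

theorem regular_proj_apply [DecidableEq G] (h a : G) (f : Fin (Fintype.card G) → K) (y : G) :
    ((regular K h).proj a f : Fin (Fintype.card G) → K) (Fintype.equivFin G y) =
      if y * h * y⁻¹ = a then f (Fintype.equivFin G y) else 0 := by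
  by_cases hc : y * h * y⁻¹ = a
  · rw [if_pos hc]
    exact if_pos (by rwa [Equiv.symm_apply_apply])
  · rw [if_neg hc]
    exact if_neg (by rwa [Equiv.symm_apply_apply])

/-- Frobenius reciprocity: a nonzero vector `w` in the fibre at `a` gives the homomorphism `f ↦ ∑
f(x) ρ(x) w`, which sends the delta function at 1 to `w`. -/
theorem exists_isHom_regular {E : Bundle K G} (hE : E.IsSimple) :
    ∃ a φ, IsHom (regular K a) E φ ∧ φ ≠ 0 := by
  classical
  obtain ⟨v, hv⟩ := @exists_ne _ hE.1 (0 : E.V)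
  obtain ⟨a, ha⟩ : ∃ a, E.proj a v ≠ 0 := by
    by_contra! h
    exact hv (by rw [← E.sum_proj v]; simp [h])
  let e := Fintype.equivFin G
  let φ : (Fin (Fintype.card G) → K) →ₗ[K] E.V :=
    Fintype.linearCombination K fun i => E.ρ (e.symm i) (E.proj a v)
  have hφ : ∀ f, φ f = ∑ x, f (e x) • E.ρ x (E.proj a v) := by
    intro f
    rw [Fintype.linearCombination_apply]
    exact Fintype.sum_equiv e.symm _ _ fun i => by simp
  refine ⟨a, φ, ⟨fun x f => ?_, fun b f => ?_⟩, fun h0 => ha ?_⟩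
  · refine (hφ _).trans (Eq.trans ?_ (congrArg (E.ρ x) (hφ f)).symm)
    rw [map_sum]
    refine Fintype.sum_equiv (Equiv.mulLeft x⁻¹) _ _ fun y => ?_
    rw [map_smul, ← Module.End.mul_apply (E.ρ x), ← map_mul]
    simp only [Equiv.coe_mulLeft, mul_inv_cancel_left]
    exact congrArg (· • E.ρ y (E.proj a v)) (regular_ρ_apply a x f y)
  · refine (hφ _).trans (Eq.trans ?_ (congrArg (E.proj b) (hφ f)).symm)
    rw [map_sum]
    refine Finset.sum_congr rfl fun y _ => ?_
    rw [map_smul, E.ρ_proj, E.proj_proj]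
    have : (regular K a).proj b f (e y) = if y * a * y⁻¹ = b then f (e y) else 0 :=
      regular_proj_apply a b f y
    rw [this]
    by_cases h : y * a * y⁻¹ = b
    · simp [h]
    · simp [h, Ne.symm h]
  · have h1 := hφ (Pi.single (e 1) 1)
    rw [h0, Finset.sum_eq_single 1] at h1
    · rw [Pi.single_eq_same, one_smul, map_one E.ρ, Module.End.one_apply] at h1
      exact h1.symm
    · intro y _ hy
      simp [hy]
    · simp

end Bundle

/-- The Grothendieck ring is finitely generated as an abelian group. -/
instance finite_grothendieckRing [CharZero K] : Module.Finite ℤ (GrothendieckRing K G) := by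
  choose S hS hS' using fun a : G => (Bundle.regular K a).exists_finite_quotients
  have hfin : (bundleClass '' ⋃ a, S a).Finite := (Set.finite_iUnion hS).image _
  refine ⟨hfin.toFinset, ?_⟩
  rw [hfin.coe_toFinset]
  have key : ∀ E : Bundle K G, bundleClass E ∈ Submodule.span ℤ (bundleClass '' ⋃ a, S a) := by
    intro E
    induction E using Bundle.induction_simple with
    | zero E h =>
      -- For the zero bundle, `[E] + [E] = [E]` forces `[E] = 0`.
      have : Bundle.Iso (E.sum E) E := by
        have : Subsingleton (E.sum E).V := inferInstanceAs (Subsingleton (E.V × E.V))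
        exact ⟨0, fun _ _ => Subsingleton.elim _ _, fun _ _ => Subsingleton.elim _ _⟩
      have := bundleClass_eq_of_iso this
      rw [bundleClass_sum, add_eq_left] at this
      rw [this]
      exact zero_mem _
    | simple E h =>
      obtain ⟨a, φ, hφ, h0⟩ := Bundle.exists_isHom_regular h
      obtain ⟨F, hF, hFE⟩ := hS' a E h φ hφ h0
      rw [← bundleClass_eq_of_iso hFE]
      exact Submodule.subset_span ⟨F, Set.mem_iUnion.2 ⟨a, hF⟩, rfl⟩
    | sum E F hE hF => rw [bundleClass_sum]; exact add_mem hE hF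
    | iso E F h hE => rwa [← bundleClass_eq_of_iso h]
  refine eq_top_iff.2 fun c _ => ?_
  obtain ⟨c, rfl⟩ := Ideal.Quotient.mk_surjective c
  induction c using FreeAbelianGroup.induction_on with
  | zero => rw [map_zero]; exact zero_mem _
  | of c =>
    induction c using BundleClass.ind with
    | h E => exact key E
  | neg c hc => rw [map_neg]; exact neg_mem (hc trivial)
  | add c d hc hd => rw [map_add]; exact add_mem (hc trivial) (hd trivial)

end

/-! ### Surjectivity of the homomorphism to the centre of the group algebra -/

section

/-- Raising `s y` to the order of `s` gives both `y ^ orderOf s` and 1. The order of `y` is then a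
power of `p` dividing a number prime to `p`. -/
theorem eq_one_of_pow_mul_eq_conj {G : Type*} [Group G] {p k : ℕ} {s x y : G}
    (hs : (orderOf s).Coprime p) (hy : y ^ p ^ k = 1) (hc : Commute s y)
    (h : s * y = x⁻¹ * s * x) : y = 1 := by
  have h1 : (x⁻¹ * s * x) ^ orderOf s = 1 := by
    have := conj_pow (i := orderOf s) (a := x⁻¹) (b := s)
    rw [inv_inv, pow_orderOf_eq_one] at this
    rw [this]
    group
  rw [← h, hc.mul_pow, pow_orderOf_eq_one, one_mul] at h1
  have h2 := Nat.Coprime.eq_one_of_dvd (Nat.Coprime.coprime_dvd_left (orderOf_dvd_of_pow_eq_one h1)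
    (hs.pow_right k)) (orderOf_dvd_of_pow_eq_one hy)
  exact orderOf_eq_one_iff.1 h2

theorem trace_eq_sum_single {K ι : Type*} [Field K] [Fintype ι] [DecidableEq ι]
    (M : Module.End K (ι → K)) : LinearMap.trace K _ M = ∑ i, M (Pi.single i 1) i := by
  rw [LinearMap.trace_eq_matrix_trace K (Pi.basisFun K ι)]
  simp [Matrix.trace]

theorem sum_mul_self_eq {K A H : Type*} [Field K] [Ring A] [Algebra K A] [Group H] [Fintype H]
    (R : H →* A) (hH : (Fintype.card H : K) ≠ 0) :
    ((Fintype.card H : K)⁻¹ • ∑ y, R y) * ((Fintype.card H : K)⁻¹ • ∑ y, R y) =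
      (Fintype.card H : K)⁻¹ • ∑ y, R y := by
  rw [smul_mul_smul_comm, Finset.sum_mul]
  have : ∀ y : H, R y * ∑ x, R x = ∑ x, R x := fun y => by
    rw [Finset.mul_sum]
    exact Fintype.sum_equiv (Equiv.mulLeft y) _ _ fun x => by simp
  simp only [this, Finset.sum_const, Finset.card_univ]
  rw [← Nat.cast_smul_eq_nsmul K, smul_smul, mul_assoc, inv_mul_cancel₀ hH, mul_one]

variable {K : Type u} {G : Type v} [Field K] [Group G] [Fintype G]

/-- The number of elements of `C_G(s)` that conjugate `h` to `a`. -/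
theorem card_conj_centralizer (s : G) (h a : Subgroup.centralizer {s}) :
    Nat.card {x : G // x ∈ Subgroup.centralizer {s} ∧ x * h * x⁻¹ = a} =
      open Classical in if IsConj h a then
        Nat.card (Subgroup.centralizer {s} ⊓ Subgroup.centralizer {(h : G)} : Subgroup G) else 0 := by
  split_ifs with hc
  · obtain ⟨c, rfl⟩ := isConj_iff.1 hc
    refine Nat.card_congr
      { toFun := fun x => ⟨(c : G)⁻¹ * x, ?_⟩, invFun := fun y => ⟨c * y, ?_⟩,
        left_inv := fun x => by simp, right_inv := fun y => by simp }
    · refine ⟨mul_mem (Subgroup.inv_mem _ c.2) x.2.1, mem_centralizer_iff'.2 ?_⟩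
      have : (x : G) * h = c * h * (c : G)⁻¹ * x := by rw [← mul_inv_eq_iff_eq_mul, x.2.2]; rfl
      rw [mul_assoc _ (x : G), this]
      group
    · refine ⟨mul_mem c.2 y.2.1, ?_⟩
      have := mem_centralizer_iff'.1 y.2.2
      have h2 : (y : G) * h * (y : G)⁻¹ = h := by rw [← this]; group
      calc (c * y : G) * h * (c * y : G)⁻¹ = c * (y * h * (y : G)⁻¹) * (c : G)⁻¹ := by group
        _ = _ := by rw [h2]; rfl
  · rw [Nat.card_eq_zero]
    refine .inl ⟨fun x => hc (isConj_iff.2 ⟨⟨x, x.2.1⟩, Subtype.ext x.2.2⟩)⟩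

/-- The permutation operators given by right translations. -/
def rightRegular (K : Type u) [Field K] (G : Type v) [Group G] [Fintype G] :
    Representation K G (Fin (Fintype.card G) → K) where
  toFun q := Bundle.permOp K (Equiv.mulRight q)
  map_one' := by ext; simp [Bundle.permOp]
  map_mul' x y := by
    refine LinearMap.ext fun f => funext fun i => ?_
    simp [Bundle.permOp, LinearMap.funLeft_apply, mul_assoc]

theorem rightRegular_apply (q : G) (f : Fin (Fintype.card G) → K) (y : G) :
    rightRegular K G q f (Fintype.equivFin G y) = f (Fintype.equivFin G (y * q)) :=
  Bundle.permOp_apply (Equiv.mulRight q) f y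

/-! ### Class sums in the image -/

section Surjective

variable [CharZero K] (D : Type*) [CommRing D]
  [Algebra D K] (hD : Function.Injective (algebraMap D K)) (s : G)
  (hs : ∀ a (c : BundleClass K G), ∃ d : D, algebraMap D K d = BundleClass.fiberTrace a s c)

/-- The spectral projectors of `T` cut out sub-bundles `E_j`. The element `∑ ζ^j ⊗ [E_j]` works
because `T = ∑ ζ^j π_j` and the trace is linear. -/
theorem exists_coeff_eq_trace {ζ : D} (hζ : IsPrimitiveRoot (algebraMap D K ζ) (orderOf s))
    (E : Bundle K G) (T : Module.End K E.V) (hT : Bundle.IsHom E E T)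
    (hTs : T ^ (orderOf s + 1) = T) :
    ∃ x, ∀ a, algebraMap D K ((toCenterAlgHom D hD s hs x).1.coeff a) =
      LinearMap.trace K E.V (E.ρ s * E.proj a * T) := by
  obtain ⟨π, h1, h2, h3⟩ := exists_idempotents_of_pow_succ_eq (orderOf_pos s).ne' hζ T hTs
  have hst : ∀ j, E.IsStable (LinearMap.range (π j)) := fun j => by
    refine Bundle.IsHom.isStable_range (E := E) ⟨fun x v => ?_, fun a v => ?_⟩
    · exact (LinearMap.congr_fun (h3 j (E.ρ x) (LinearMap.ext fun w => (hT.1 x w).symm)) v).symm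
    · exact (LinearMap.congr_fun (h3 j (E.proj a) (LinearMap.ext fun w => (hT.2 a w).symm)) v).symm
  refine ⟨∑ j ∈ Finset.range (orderOf s), (ζ ^ j) ⊗ₜ bundleClass (E.sub _ (hst j)), fun a => ?_⟩
  let κ : Subalgebra.center D (MonoidAlgebra D (Subgroup.centralizer {s})) →+ K :=
    { toFun := fun z => algebraMap D K (z.1.coeff a)
      map_zero' := by simp
      map_add' := fun x y => by simp }
  change κ _ = _
  rw [map_sum, map_sum]
  conv_rhs => rw [h2, Finset.mul_sum, map_sum]
  refine Finset.sum_congr rfl fun j _ => ?_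
  refine (coeff_toCenterAlgHom_tmul D hD s hs _ _ a).trans ?_
  rw [E.fiberTrace_sub_range (h1 j), mul_smul_comm, map_smul, map_pow, smul_eq_mul]

open Classical in
-- A class sum is obtained up to the factor `[N : P]`. Averaging over the Sylow subgroup `P` removes
-- the `p`-part of `|N|`, which would otherwise appear in this factor and not be invertible.
theorem exists_coeff_eq_classSum (p : ℕ) [Fact p.Prime] (hsp : (orderOf s).Coprime p) {ζ : D}
    (hζ : IsPrimitiveRoot (algebraMap D K ζ) (orderOf s)) (h : Subgroup.centralizer {s}) :
    ∃ x, ∃ d : ℕ, d.Coprime p ∧ ∀ a, (toCenterAlgHom D hD s hs x).1.coeff a =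
      if IsConj h a then (d : D) else 0 := by
  let N : Subgroup G := Subgroup.centralizer {s} ⊓ Subgroup.centralizer {(h : G)}
  let P : Sylow p N := default
  let R := rightRegular K G
  let j : P →* G := N.subtype.comp P.toSubgroup.subtype
  let c : K := (Fintype.card P : K)⁻¹
  have hP : (Fintype.card P : K) ≠ 0 := Nat.cast_ne_zero.2 Fintype.card_ne_zero
  let π : Module.End K (Fin (Fintype.card G) → K) := c • ∑ y : P, R (j y)
  have hj1 : ∀ y, Commute s (j y) := fun y => mem_centralizer_iff'.1 y.1.2.1
  have hj2 : ∀ y, Commute (h : G) (j y) := fun y => mem_centralizer_iff'.1 y.1.2.2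
  have hsh : Commute s (h : G) := mem_centralizer_iff'.1 h.2
  have hπ : IsIdempotentElem π := sum_mul_self_eq (R.comp j) hP
  have hRπ : Commute (R s) π :=
    (Commute.sum_right _ _ _ fun y _ => (hj1 y).map R).smul_right _
  let T : Module.End K (Fin (Fintype.card G) → K) := R s * π
  have hTs : T ^ (orderOf s + 1) = T := by
    rw [hRπ.mul_pow, hπ.pow_succ_eq, ← map_pow, pow_succ, pow_orderOf_eq_one, one_mul]
  let e := Fintype.equivFin G
  have hTf : ∀ f x, T f (e x) = c * ∑ y : P, f (e (x * s * j y)) := by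
    intro f x
    have : T f (e x) = π f (e (x * s)) := rightRegular_apply s (π f) x
    rw [this]
    simp only [π, LinearMap.smul_apply, LinearMap.sum_apply, Pi.smul_apply, Finset.sum_apply,
      smul_eq_mul]
    congr 1
    exact Finset.sum_congr rfl fun y _ => rightRegular_apply (j y) f (x * s)
  have hext : ∀ {f g : Fin (Fintype.card G) → K}, (∀ x, f (e x) = g (e x)) → f = g :=
    fun h => funext fun i => by simpa using h (e.symm i)
  have hT : Bundle.IsHom (Bundle.regular K (h : G)) (Bundle.regular K (h : G)) T := by
    refine ⟨fun g f => hext fun x => ?_, fun b f => hext fun x => ?_⟩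
    · refine (hTf _ x).trans (Eq.trans ?_ (Bundle.regular_ρ_apply (h : G) g (T f) x).symm)
      refine Eq.trans ?_ (hTf f (g⁻¹ * x)).symm
      congr 1
      refine Finset.sum_congr rfl fun y _ => ?_
      refine (Bundle.regular_ρ_apply (h : G) g f _).trans ?_
      simp only [mul_assoc, e]
    · refine (hTf _ x).trans (Eq.trans ?_ (Bundle.regular_proj_apply (h : G) b (T f) x).symm)
      -- Both `s` and `j y` centralize `h`, so translating `x` on the right by `s * j y` does not
      -- change the fibre containing it.
      have hy : ∀ y, x * s * j y * h * (x * s * j y)⁻¹ = x * h * x⁻¹ := fun y => by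
        have h1 : s * j y * h = h * (s * j y) := ((hsh.symm.mul_right (hj2 y)).eq).symm
        calc x * s * j y * h * (x * s * j y)⁻¹ = x * (s * j y * h) * (s * j y)⁻¹ * x⁻¹ := by group
          _ = _ := by rw [h1]; group
      have : ∀ y, ((Bundle.regular K (h : G)).proj b f : Fin (Fintype.card G) → K)
          (e (x * s * j y)) = if x * h * x⁻¹ = b then f (e (x * s * j y)) else 0 := fun y => by
        refine (Bundle.regular_proj_apply (h : G) b f _).trans ?_
        rw [hy]
      simp only [this]
      split_ifs
      · exact (hTf f x).symm
      · simp
  obtain ⟨x, hx⟩ := exists_coeff_eq_trace D hD s hs hζ (Bundle.regular K (h : G)) T hT hTs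
  refine ⟨x, P.toSubgroup.index, ?_, fun a => hD ?_⟩
  · exact ((Fact.out : p.Prime).coprime_iff_not_dvd.2 P.not_dvd_index).symm
  · refine (hx a).trans ?_
    change LinearMap.trace K (Fin (Fintype.card G) → K) _ = _
    refine (trace_eq_sum_single _).trans ?_
    -- A diagonal matrix entry at `x` gets a contribution from `y` only if `s y = x⁻¹ s x`. Since
    -- `s` is a `p'`-element, this leaves `y = 1` and `x ∈ C_G(s)`.
    have hy1 : ∀ (x : G) (y : P), s⁻¹ * x * s * j y = x ↔
        x ∈ Subgroup.centralizer {s} ∧ y = 1 := by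
      intro x y
      constructor
      · intro hxy
        have h1 : s * j y = x⁻¹ * s * x := by
          calc s * j y = x⁻¹ * s * (s⁻¹ * x * s * j y) := by group
            _ = _ := by rw [hxy]
        obtain ⟨k, hk⟩ := P.2 y
        have hjy : j y = 1 := eq_one_of_pow_mul_eq_conj (k := k) hsp
          (by rw [← map_pow, hk, map_one]) (hj1 y) h1
        refine ⟨mem_centralizer_iff'.2 ?_, Subtype.ext (Subtype.ext hjy)⟩
        rw [hjy, mul_one] at h1
        rw [← mul_inv_cancel_left x (s * x), ← mul_assoc x⁻¹, ← h1]
      · rintro ⟨hx, rfl⟩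
        have := mem_centralizer_iff'.1 hx
        rw [map_one, mul_one, mul_assoc, ← this, inv_mul_cancel_left]
    have hdiag : ∀ x : G, ((Bundle.regular K (h : G)).ρ s ((Bundle.regular K (h : G)).proj a
        (T (Pi.single (e x) 1))) : Fin (Fintype.card G) → K) (e x) =
        if x ∈ Subgroup.centralizer {s} ∧ x * h * x⁻¹ = a then c else 0 := by
      intro x
      refine (Bundle.regular_ρ_apply (h : G) s _ x).trans ?_
      refine (Bundle.regular_proj_apply (h : G) a _ (s⁻¹ * x)).trans ?_
      have h1 := hTf (Pi.single (e x) 1) (s⁻¹ * x)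
      simp only [Pi.single_apply, EmbeddingLike.apply_eq_iff_eq, hy1] at h1
      have h2 : s⁻¹ * x * h * (s⁻¹ * x)⁻¹ = s⁻¹ * (x * h * x⁻¹) * s := by group
      by_cases hxs : x ∈ Subgroup.centralizer {s}
      · have h3 : s⁻¹ * (x * h * x⁻¹) * s = x * h * x⁻¹ := by
          have : s * (x * h * x⁻¹) = x * h * x⁻¹ * s := mem_centralizer_iff'.1
            (mul_mem (mul_mem hxs h.2) (inv_mem hxs))
          rw [mul_assoc, ← this, inv_mul_cancel_left]
        rw [h2, h3]
        simp only [hxs, true_and, Finset.sum_ite_eq', Finset.mem_univ, if_true, mul_one] at h1 ⊢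
        split_ifs
        · exact h1
        · rfl
      · simp only [hxs, false_and, if_false, Finset.sum_const_zero, mul_zero] at h1 ⊢
        split_ifs
        · exact h1
        · rfl
    rw [← Equiv.sum_comp e]
    refine (Finset.sum_congr rfl fun x _ => hdiag x).trans ?_
    rw [← Finset.sum_filter, Finset.sum_const, ← Fintype.card_subtype, ← Nat.card_eq_fintype_card,
      card_conj_centralizer, nsmul_eq_mul]
    split_ifs
    -- Each `a` conjugate to `h` in `C_G(s)` is reached by `|N|` elements `x`, each of weight
    -- `1/|P|`.
    · have hcard : Nat.card N = Nat.card P * P.toSubgroup.index :=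
        (P.toSubgroup.card_mul_index).symm
      change (Nat.card N : K) * c = _
      rw [hcard, Nat.card_eq_fintype_card, Nat.cast_mul, mul_comm, ← mul_assoc,
        inv_mul_cancel₀ hP, one_mul, map_natCast]
    · simp

/-- If the order of `s` is prime to `p`, then `toCenterAlgHom` is surjective. -/
theorem toCenterAlgHom_surjective (p : ℕ) [Fact p.Prime] (hsp : (orderOf s).Coprime p) {ζ : D}
    (hζ : IsPrimitiveRoot (algebraMap D K ζ) (orderOf s))
    (hu : ∀ n : ℕ, n.Coprime p → IsUnit (n : D)) :
    Function.Surjective (toCenterAlgHom D hD s hs) := by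
  classical
  intro z
  choose x d hd hx using exists_coeff_eq_classSum D hD s hs p hsp hζ
  choose u hu' using fun h => (hu (d h) (hd h)).exists_right_inv
  let _ : Fintype (ConjClasses (Subgroup.centralizer {s})) := Fintype.ofFinite _
  -- A central element is a combination of class sums; `u` inverts the factor prime to `p` that each
  -- preimage carries.
  refine ⟨∑ C : ConjClasses (Subgroup.centralizer {s}), (z.1.coeff C.out * u C.out) • x C.out,
    center_ext fun a => ?_⟩
  let κ : Subalgebra.center D (MonoidAlgebra D (Subgroup.centralizer {s})) →ₗ[D] D :=
    { toFun := fun z => z.1.coeff a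
      map_add' := fun x y => by simp
      map_smul' := fun c x => by simp }
  change κ _ = _
  rw [map_sum, map_sum, Finset.sum_eq_single (ConjClasses.mk a)]
  · have hc : IsConj (Quotient.out (ConjClasses.mk a)) a :=
      ConjClasses.mk_eq_mk_iff_isConj.1 (Quotient.out_eq (ConjClasses.mk a))
    have h1 : κ (toCenterAlgHom D hD s hs (x (Quotient.out (ConjClasses.mk a)))) = _ :=
      (hx _ a).trans (if_pos hc)
    rw [map_smul, map_smul, h1, smul_eq_mul, mul_assoc, mul_comm (u _), hu', mul_one]
    obtain ⟨c, hc⟩ := isConj_iff.1 hc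
    have := coeff_conj_of_mem_center z c (Quotient.out (ConjClasses.mk a))
    rw [hc] at this
    exact this.symm
  · intro C _ hC
    have hc : ¬ IsConj (Quotient.out C) a := fun h =>
      hC ((Quotient.out_eq C).symm.trans (ConjClasses.mk_eq_mk_iff_isConj.2 h))
    have h1 : κ (toCenterAlgHom D hD s hs (x (Quotient.out C))) = _ :=
      (hx _ a).trans (if_neg hc)
    rw [map_smul, map_smul, h1, smul_zero]
  · simp

end Surjective

end

/-! ### Blocks -/

/-- Conjugation identifies the two centralizers and preserves fibre traces. Membership of an orbit
in a block can therefore be tested on any representative. -/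
theorem psi_eq_of_conj {K : Type u} {G : Type v} [Field K] [Group G] [Fintype G]
    {P Q : IrrPairs K G} (h : IrrPairs.Conj P Q) : psi P = psi Q := by
  classical
  obtain ⟨x, hx, h⟩ := h
  have h1 : Q.2.1 1 = P.2.1 1 := h 1 1 (by simp)
  have key : ∀ E : Bundle K G, psiHom P (bundleClass E) = psiHom Q (bundleClass E) := by
    intro E
    rw [psiHom_bundleClass, psiHom_bundleClass, h1]
    congr 1
    refine Fintype.sum_bijective
      (fun a => ⟨x * a * x⁻¹, hx ▸ conj_mem_centralizer x a.2⟩) ⟨?_, ?_⟩ _ _ ?_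
    · intro a b hab
      have := congrArg Subtype.val hab
      exact Subtype.ext (by simpa using this)
    · intro b
      have hb := conj_mem_centralizer x⁻¹ b.2
      have hP : x⁻¹ * Q.1 * x⁻¹⁻¹ = P.1 := by rw [hx]; group
      rw [hP] at hb
      exact ⟨⟨_, hb⟩, Subtype.ext (by simp [mul_assoc])⟩
    · intro a
      have ht := E.fiberTrace_conj a P.1 x
      rw [← hx] at ht
      rw [h a _ rfl, ht]
  refine LinearMap.ext fun y => ?_
  induction y using GrothendieckRing.tmul_induction with
  | h r E =>
    simp only [psi, LinearMap.liftBaseChange_tmul]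
    exact congrArg (r • ·) (key E)
  | hadd y z hy hz => rw [map_add, map_add, hy, hz]

theorem mk_mem_pairsOfIdempotent {p : ℕ} [Fact p.Prime] {K : Type u} {G : Type v} [Field K]
    [Algebra ℤ_[p] K] [Group G] [Fintype G] (P : IrrPairs K G)
    (e : IntegralGrothendieckRing p K G) :
    MPairs.mk P ∈ pairsOfIdempotent p e ↔ psi P (toFieldCoeff p K G e) = 1 := by
  refine ⟨?_, fun h => ⟨P, rfl, h⟩⟩
  rintro ⟨Q, hQ, h⟩
  rwa [psi_eq_of_conj (Quotient.exact hQ : IrrPairs.Conj Q P)] at h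

section

variable (p : ℕ) [Fact p.Prime] (K : Type u) [Field K] [Algebra ℚ_[p] K]
    [FiniteDimensional ℚ_[p] K] [Algebra ℤ_[p] K] [IsScalarTower ℤ_[p] ℚ_[p] K]

theorem finite_center_monoidAlgebra (H : Type v) [Group H] [Finite H] : Module.Finite ℤ_[p]
    (Subalgebra.center (IntegersOver p K) (MonoidAlgebra (IntegersOver p K) H)) := by
  have : IsNoetherianRing (IntegersOver p K) := IsNoetherianRing.of_finite ℤ_[p] _
  have : Module.Finite (IntegersOver p K) (MonoidAlgebra (IntegersOver p K) H) :=
    Module.Finite.equiv (MonoidAlgebra.coeffLinearEquiv (IntegersOver p K)).symm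
  have : Module.Finite (IntegersOver p K)
      (Subalgebra.center (IntegersOver p K) (MonoidAlgebra (IntegersOver p K) H)) :=
    Module.Finite.of_injective (Subalgebra.val _).toLinearMap Subtype.val_injective
  exact Module.Finite.trans (IntegersOver p K) _

theorem finite_integralGrothendieckRing (G : Type v) [Group G] [Fintype G] :
    Module.Finite ℤ_[p] (IntegralGrothendieckRing p K G) := by
  have := charZero_of_algebra_padic p K
  exact Module.Finite.trans (IntegersOver p K) _

end

end EquivBlocks

end

/-! ### Comparison of the two kinds of blocks -/

theorem mainTheorem3 (p : ℕ) [Fact p.Prime] (K : Type*) [Field K] [Algebra ℚ_[p] K]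
    [FiniteDimensional ℚ_[p] K] [Algebra ℤ_[p] K] [IsScalarTower ℤ_[p] ℚ_[p] K]
    (G : Type*) [Group G] [Fintype G]
    (hsplit : ∀ H : Subgroup G, EquivBlocks.IsSplitGroupAlgebra K H)
    (s : G) (hs : (orderOf s).Coprime p)
    (σ σ' : EquivBlocks.Irr K (Subgroup.centralizer {s})) :
    (∃ B : Set (EquivBlocks.MPairs K G), EquivBlocks.IsMBlock p K G B ∧
      EquivBlocks.MPairs.mk ⟨s, σ⟩ ∈ B ∧ EquivBlocks.MPairs.mk ⟨s, σ'⟩ ∈ B) ↔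
    (∃ b : Set (Subgroup.centralizer {s} → K),
      EquivBlocks.IsGroupBlock p K (Subgroup.centralizer {s}) b ∧ σ.1 ∈ b ∧ σ'.1 ∈ b) := by
  open EquivBlocks in
  have := charZero_of_algebra_padic p K
  have := finite_center_monoidAlgebra p K (Subgroup.centralizer {s})
  have := finite_integralGrothendieckRing p K G
  obtain ⟨m, hm, hpm⟩ := exists_isPrime_natCast_mem p K
  obtain ⟨hσ, ω, hω, hω1⟩ := exists_centralCharacter (p := p) (hsplit _) σ.2
  obtain ⟨hσ', ω', hω', hω1'⟩ := exists_centralCharacter (p := p) (hsplit _) σ'.2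
  obtain ⟨ζ, hζ⟩ := exists_isPrimitiveRoot_of_split s (hsplit _)
  have hD : Function.Injective (algebraMap (IntegersOver p K) K) := Subtype.val_injective
  have htr := exists_algebraMap_eq_fiberTrace p s hζ
  let Φ := toCenterAlgHom (IntegersOver p K) hD s htr
  have hζi : IsIntegral ℤ_[p] ζ := IsIntegral.of_pow (orderOf_pos s)
    (by rw [hζ.pow_eq_one]; exact isIntegral_one)
  have hΦ : Function.Surjective Φ := toCenterAlgHom_surjective (IntegersOver p K) hD s htr p hs
    (ζ := ⟨ζ, hζi⟩) hζ fun n hn => isUnit_natCast_integersOver hn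
  have h1 := exists_block_iff_congr p m hpm (ω.comp Φ) (ω'.comp Φ)
  have h2 := exists_block_iff_congr p (R := Subalgebra.center (IntegersOver p K)
    (MonoidAlgebra (IntegersOver p K) (Subgroup.centralizer {s}))) m hpm ω ω'
  -- Congruence on the image of `Φ` is congruence on the whole centre, by surjectivity.
  have h3 : (∀ x, (ω.comp Φ) x - (ω'.comp Φ) x ∈ m) ↔ ∀ x, ω x - ω' x ∈ m :=
    ⟨fun h x => by obtain ⟨y, rfl⟩ := hΦ x; exact h y, fun h x => h (Φ x)⟩
  have hψ : ∀ e, MPairs.mk ⟨s, σ⟩ ∈ pairsOfIdempotent p e ↔ (ω.comp Φ) e = 1 := fun e => by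
    rw [mk_mem_pairsOfIdempotent, psi_eq_centralCharacter p s hD htr σ hσ ω hω]
    exact (Subtype.ext_iff (a1 := ω (Φ e)) (a2 := 1)).symm
  have hψ' : ∀ e, MPairs.mk ⟨s, σ'⟩ ∈ pairsOfIdempotent p e ↔ (ω'.comp Φ) e = 1 := fun e => by
    rw [mk_mem_pairsOfIdempotent, psi_eq_centralCharacter p s hD htr σ' hσ' ω' hω']
    exact (Subtype.ext_iff (a1 := ω' (Φ e)) (a2 := 1)).symm
  calc _ ↔ ∃ e, IsBlockIdempotent e ∧ (ω.comp Φ) e = 1 ∧ (ω'.comp Φ) e = 1 := by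
        constructor
        · rintro ⟨_, ⟨e, he, rfl⟩, h, h'⟩
          exact ⟨e, he, (hψ e).1 h, (hψ' e).1 h'⟩
        · rintro ⟨e, he, h, h'⟩
          exact ⟨_, ⟨e, he, rfl⟩, (hψ e).2 h, (hψ' e).2 h'⟩
    _ ↔ ∃ e, IsBlockIdempotent e ∧ ω e = 1 ∧ ω' e = 1 := h1.trans (h3.trans h2.symm)
    _ ↔ _ := by
        constructor
        · rintro ⟨e, he, h, h'⟩
          exact ⟨_, ⟨e.1, (isBlockIdempotent_center_iff e).1 he, rfl⟩, (hω1 e).2 h, (hω1' e).2 h'⟩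
        · rintro ⟨_, ⟨e, he, rfl⟩, h, h'⟩
          exact ⟨⟨e, he.mem_center⟩, (isBlockIdempotent_center_iff ⟨e, he.mem_center⟩).2 he,
            (hω1 ⟨e, he.mem_center⟩).1 h, (hω1' ⟨e, he.mem_center⟩).1 h'⟩
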